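/- **Setting (one round of CEPAM-Gaussian).** There are $K\ge1$ clients; client $k$ holds data $\mathcal D^{(k)}=(\xi_{k,1},\dots,\xi_{k,N_k})$, $N_k=|\mathcal D^{(k)}|\ge 1$. Let $m\ge0$ be the number of model parameters, $n\ge1$ the lattice dimension, $\tau\ge1$ the number of local iterations, $\gamma>0$ the clipping threshold, $\sigma>0$. Let $\ell(\mathbf W;\xi)$ be a loss function and $\eta_1,\dots,\eta_\tau$ learning rates. Starting from the global model $\mathbf W\in\mathbb R^m$, client $k$ performs $\tau$ steps $\mathbf w\leftarrow\mathbf w-\eta_s\nabla\ell(\mathbf w;\xi_{k,J^k_s})$, $s=1,\dots,\tau$, with indices $J^k_s$ uniform on $\{1,\dots,N_k\}$; $\mathbf X^k$ is the final local model minus $\mathbf W$, and $\tilde{\mathbf X}^k=\mathbf X^k/\max\{1,\|\mathbf X^k\|_2/\gamma\}$ is the clipped update. It is divided into $M=\lceil m/n\rceil$ sub-vectors $\tilde{\mathbf X}^k_j\in\mathbb R^n$ (the last one padded with zeros). Let $\mathbf G\in\mathbb R^{n\times n}$ be non-singular and let $\mathcal P\subset\mathbb R^n$ be a bounded measurable basic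 cell of the lattice $\mathbf G\mathbb Z^n$ (the translates $\mathcal P+\mathbf G\mathbf a$, $\mathbf a\in\mathbb Z^n$, partition $\mathbb R^n$); $Q_{\mathcal P}(\mathbf x)$ is the lattice point $\mathbf y$ with $\mathbf y-\mathbf x\in\mathcal P$. Let $B^n$ be the closed unit ball and let $\beta$ be measurable, with $\beta(u)\ge0$ and $\sigma\sqrt u\,B^n\subseteq\beta(u)\mathcal P$ for all $u>0$. For every $k$ and $j$, client $k$ and the server share a latent variable $\tilde U^k_j\sim\chi^2_{n+2}$ and dithers $\mathbf V^k_{j,1},\mathbf V^k_{j,2},\dots\sim\mathrm{Unif}(\mathcal P)$. The variables $\mathbf W$, $J^k_s$, $\tilde U^k_j$, $\mathbf V^k_{j,i}$ are mutually independent. With $u=\tilde U^k_j$, the encoder of the layered rejection-sampled universal quantizer (LRSUQ) finds the first $h$ such that $\beta(u)\big(Q_{\mathcal P}(\tilde{\mathbf X}^k_j/\beta(u)-\mathbf V^k_{j,h})+\mathbf V^k_{j,h}\big)-\tilde{\mathbf X}^k_j\in\sigma\sqrt u\,B^n$, and sends $h$ and $\mathbf M=Q_{\mathcal P}(\tilde{\mathbf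 X}^k_j/\beta(u)-\mathbf V^k_{j,h})$; the server decodes $\mathbf Y^k_j=\beta(u)(\mathbf M+\mathbf V^k_{j,h})$ and collects $(\mathbf Y^k_j)_{j\le M}$ (dropping the padding) into the estimate $\hat{\mathbf X}^k\in\mathbb R^m$. Let $\tilde{\mathbf Z}^k_j=\mathbf Y^k_j-\tilde{\mathbf X}^k_j$ be the quantization errors. **Theorem.** 1. For all $k,j$, conditionally on $\tilde U^k_j=u$, the error $\tilde{\mathbf Z}^k_j$ is uniform on $\sigma\sqrt u\,B^n$ (for almost every $u$), and $\tilde{\mathbf Z}^k_j\sim\mathcal N(\mathbf 0,\sigma^2\mathbf I_n)$. The errors are independent over $(k,j)$, and the family of all errors is independent of $(\tilde{\mathbf X}^k)_{k}$. So the mechanism $\mathbf Y^k_j=\tilde{\mathbf X}^k_j+\tilde{\mathbf Z}^k_j$ is Gaussian. 2. The average of the decoded updates satisfies $$\frac1K\sum_{k=1}^K\hat{\mathbf X}^k=\frac1K\sum_{k=1}^K\tilde{\mathbf X}^k+\boldsymbol\zeta,\qquad \boldsymbol\zeta\sim\mathcal N\Big(\mathbf 0,\frac{\sigma^2}K\mathbf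 I_m\Big),$$ with $\boldsymbol\zeta$ independent of $(\tilde{\mathbf X}^k)_k$. 3. For every $\tilde\epsilon>0$, every client $k$ and every fixed global model $\mathbf W$ at the start of the round, the mechanism that maps the collection of local datasets to $\frac1K\sum_{k'}\hat{\mathbf X}^{k'}$ is $(\epsilon,\delta)$-differentially private with respect to replacing one entry of $\mathcal D^{(k)}$: for all collections $D,D'$ of local datasets (of the same sizes) that differ in one entry of client $k$'s dataset, and all measurable $T\subseteq\mathbb R^m$, the probability that the output on $D$ lies in $T$ is at most $e^\epsilon$ times the probability that the output on $D'$ lies in $T$, plus $\delta$. Here $\epsilon=\ln\big(1+p(e^{\tilde\epsilon}-1)\big)$, $p=1-\big(1-\frac1{N_k}\big)^\tau$, and $$\delta=\sum_{j=1}^{\tau}\binom{\tau}{j}\Big(\frac1{N_k}\Big)^j\Big(1-\frac1{N_k}\Big)^{\tau-j}\frac{e^{\tilde\epsilon}-1}{e^{\tilde\epsilon/j}-1}\left(\Phi\Big(\frac{\tau\gamma}{\sqrt K\sigma}-\frac{\sqrt K\tilde\epsilon\sigma}{2j\tau\gamma}\Big)-e^{\tilde\epsilon/j}\,\Phi\Big(-\frac{\tau\gamma}{\sqrt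 K\sigma}-\frac{\sqrt K\tilde\epsilon\sigma}{2j\tau\gamma}\Big)\right),$$ with $\Phi$ the standard Gaussian cdf. -/

import Mathlib

open MeasureTheory ProbabilityTheory
open scoped Pointwise

noncomputable section

namespace CEPAM

/-- `ℝ^d` with the Euclidean norm. -/
abbrev Vec (d : ℕ) : Type := EuclideanSpace ℝ (Fin d)

/-! ### Lattice quantizer and layered rejection-sampled universal quantizer -/

/-- The lattice point `G a`, for an integer vector `a`. -/
def latticePoint {d : ℕ} (G : Matrix (Fin d) (Fin d) ℝ) (a : Fin d → ℤ) : Vec d :=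
  WithLp.toLp 2 (G.mulVec fun i => (a i : ℝ))

/-- A bounded set `P` is a basic cell of the lattice `G ℤ^d` if the translates `P + G a`,
`a ∈ ℤ^d`, partition the space: every point lies in exactly one of them. -/
structure IsBasicCell {d : ℕ} (G : Matrix (Fin d) (Fin d) ℝ) (P : Set (Vec d)) : Prop where
  bounded : Bornology.IsBounded P
  partition : ∀ x : Vec d, ∃! a : Fin d → ℤ, x - latticePoint G a ∈ P

open Classical in
/-- The lattice quantizer of the basic cell `P`: the lattice point `y` with `x ∈ -P + y`, that is
`y - x ∈ P` (it exists and is unique when `P` is a basic cell). -/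
def latticeQuantizer {d : ℕ} (G : Matrix (Fin d) (Fin d) ℝ) (P : Set (Vec d)) (x : Vec d) :
    Vec d :=
  if h : ∃ a : Fin d → ℤ, latticePoint G a - x ∈ P then latticePoint G h.choose else 0

/-- Encoder of the layered rejection-sampled universal quantizer on one sub-vector `x`, with
acceptance region `A u` and scale `β u` for the latent value `u`, and dithers `v 0, v 1, …`:
the number `h` of the first accepted dither, and the lattice point sent for it. -/
def encodeSub {d : ℕ} (G : Matrix (Fin d) (Fin d) ℝ) (P : Set (Vec d)) (β : ℝ → ℝ)
    (A : ℝ → Set (Vec d)) (x : Vec d) (u : ℝ) (v : ℕ → Vec d) : ℕ × Vec d :=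
  let h : ℕ :=
    sInf {i | β u • (latticeQuantizer G P ((β u)⁻¹ • x - v i) + v i) - x ∈ A u}
  (h, latticeQuantizer G P ((β u)⁻¹ • x - v h))

/-- Decoder on one sub-vector: from the message `(h, M)`, the latent value `u` and the dithers,
the vector `β u • (M + v h)`. -/
def decodeSub {d : ℕ} (β : ℝ → ℝ) (u : ℝ) (v : ℕ → Vec d) (msg : ℕ × Vec d) : Vec d :=
  β u • (msg.2 + v msg.1)

/-- The layers of the Gaussian scheme: the ball `σ √u B^d`. -/
def gaussianLayer (d : ℕ) (σ u : ℝ) : Set (Vec d) := Metric.closedBall 0 (σ * √u)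

/-! ### Splitting an `m`-dimensional vector into `⌈m / d⌉` sub-vectors of dimension `d` -/

/-- The `j`-th sub-vector of `x` (the last one is padded with zeros if `d` does not
divide `m`). -/
def subVec {m : ℕ} (d : ℕ) (x : Vec m) (j : Fin (m ⌈/⌉ d)) : Vec d :=
  WithLp.toLp 2 fun l => if h : (j : ℕ) * d + l < m then x ⟨(j : ℕ) * d + l, h⟩ else 0

lemma div_lt_ceilDiv {m d : ℕ} (i : Fin m) (hd : 0 < d) : (i : ℕ) / d < m ⌈/⌉ d := by
  rw [Nat.ceilDiv_eq_add_pred_div, Nat.div_lt_iff_lt_mul hd]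
  have h1 := Nat.div_add_mod (m + d - 1) d
  have h2 := Nat.mod_lt (m + d - 1) hd
  have h3 := i.isLt
  rw [mul_comm] at h1
  omega

/-- Collect sub-vectors into an `m`-dimensional vector (dropping the padding). -/
def collect {m d : ℕ} [NeZero d] (y : Fin (m ⌈/⌉ d) → Vec d) : Vec m :=
  WithLp.toLp 2 fun i =>
    y ⟨(i : ℕ) / d, div_lt_ceilDiv i (NeZero.pos d)⟩ ⟨(i : ℕ) % d, Nat.mod_lt _ (NeZero.pos d)⟩

/-! ### One round of the protocol -/

/-- Norm clipping: `x / max {1, ‖x‖ / γ}`. -/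
def clip {m : ℕ} (γ : ℝ) (x : Vec m) : Vec m := (max 1 (‖x‖ / γ))⁻¹ • x

/-- The parameters of the Gaussian scheme: loss `ℓ`, learning rates `η` of the `τ` local
iterations of the round, clipping threshold `γ`, noise level `σ`, generator matrix `G`,
basic cell `P`, scaling function `β`. -/
structure Setup (𝒰 : Type*) (m d τ : ℕ) where
  ℓ : Vec m → 𝒰 → ℝ
  η : Fin τ → ℝ
  γ : ℝ
  γ_pos : 0 < γ
  σ : ℝ
  σ_pos : 0 < σ
  G : Matrix (Fin d) (Fin d) ℝ
  G_nonsingular : G.det ≠ 0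
  P : Set (Vec d)
  P_cell : IsBasicCell G P
  P_measurable : MeasurableSet P
  β : ℝ → ℝ
  β_measurable : Measurable β
  β_nonneg : ∀ u, 0 < u → 0 ≤ β u
  layer_subset : ∀ u, 0 < u → gaussianLayer d σ u ⊆ β u • P

namespace Setup

variable {𝒰 : Type*} {m d τ : ℕ} (S : Setup 𝒰 m d τ)

/-- The local parameter vector after the `τ` SGD steps on the samples `ξ 0, …, ξ (τ - 1)`,
started at `w`. -/
def localSGD (w : Vec m) (ξ : Fin τ → 𝒰) : Vec m :=
  Fin.foldl τ (fun w' t => w' - S.η t • gradient (fun z => S.ℓ z (ξ t)) w') w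

/-- The clipped model update of a client. -/
def clippedUpdate (w : Vec m) (ξ : Fin τ → 𝒰) : Vec m := clip S.γ (S.localSGD w ξ - w)

/-- The messages sent by a client with clipped update `x`. -/
def encode (x : Vec m) (u : Fin (m ⌈/⌉ d) → ℝ) (v : Fin (m ⌈/⌉ d) → ℕ → Vec d) :
    Fin (m ⌈/⌉ d) → ℕ × Vec d :=
  fun j => encodeSub S.G S.P S.β (gaussianLayer d S.σ) (subVec d x j) (u j) (v j)

/-- The decoded sub-vectors at the server. -/
def decode (u : Fin (m ⌈/⌉ d) → ℝ) (v : Fin (m ⌈/⌉ d) → ℕ → Vec d)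
    (msg : Fin (m ⌈/⌉ d) → ℕ × Vec d) : Fin (m ⌈/⌉ d) → Vec d :=
  fun j => decodeSub S.β (u j) (v j) (msg j)

/-- The sub-vectors that the server decodes from the messages of a client with clipped
update `x`. -/
def decodedSub (x : Vec m) (u : Fin (m ⌈/⌉ d) → ℝ) (v : Fin (m ⌈/⌉ d) → ℕ → Vec d) :
    Fin (m ⌈/⌉ d) → Vec d :=
  S.decode u v (S.encode x u v)

/-- The quantization error on the `j`-th sub-vector. -/
def subError (x : Vec m) (u : Fin (m ⌈/⌉ d) → ℝ) (v : Fin (m ⌈/⌉ d) → ℕ → Vec d)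
    (j : Fin (m ⌈/⌉ d)) : Vec d :=
  S.decodedSub x u v j - subVec d x j

/-- The server's estimate of the update of a client. -/
def estimate [NeZero d] (x : Vec m) (u : Fin (m ⌈/⌉ d) → ℝ)
    (v : Fin (m ⌈/⌉ d) → ℕ → Vec d) : Vec m :=
  collect (S.decodedSub x u v)

end Setup

/-- The chi-squared distribution with `r` degrees of freedom. -/
def chiSquared (r : ℕ) : Measure ℝ := gammaMeasure ((r : ℝ) / 2) (1 / 2)

/-- The randomness of one round that starts from the global model `W`: sample indices `J k t`,
uniform on the `N k` data of client `k`; for every client `k` and sub-vector `j` a latent variable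
`U k j ~ χ²_{d+2}` and dithers `V k j i ~ Unif P`, `i ∈ ℕ`. The variables `W`, `J k t`, `U k j`,
`V k j i` are mutually independent. -/
structure IsRoundRandomness {Ω : Type*} [MeasurableSpace Ω] (μ : Measure Ω) {K m d τ : ℕ}
    (N : Fin K → ℕ) (P : Set (Vec d)) (W : Ω → Vec m) (J : ∀ k, Fin τ → Ω → Fin (N k))
    (U : Fin K → Fin (m ⌈/⌉ d) → Ω → ℝ) (V : Fin K → Fin (m ⌈/⌉ d) → ℕ → Ω → Vec d) :
    Prop where
  W_measurable : Measurable W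
  J_measurable : ∀ k t, Measurable (J k t)
  U_measurable : ∀ k j, Measurable (U k j)
  V_measurable : ∀ k j i, Measurable (V k j i)
  J_law : ∀ k t, HasLaw (J k t) (uniformOn Set.univ) μ
  U_law : ∀ k j, HasLaw (U k j) (chiSquared (d + 2)) μ
  V_law : ∀ k j i, HasLaw (V k j i) (volume[|P]) μ
  J_indep : iIndepFun (fun (p : Fin K × Fin τ) => J p.1 p.2) μ
  V_indep : ∀ k j, iIndepFun (fun i => V k j i) μ
  U_V_indep : ∀ k j, IndepFun (U k j) (fun ω i => V k j i ω) μ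
  shared_indep : iIndepFun
    (fun (p : Fin K × Fin (m ⌈/⌉ d)) ω => (U p.1 p.2 ω, fun i => V p.1 p.2 i ω)) μ
  W_J_indep : IndepFun W (fun ω k t => J k t ω) μ
  train_shared_indep : IndepFun (fun ω => (W ω, fun k t => J k t ω))
    (fun ω (p : Fin K × Fin (m ⌈/⌉ d)) => (U p.1 p.2 ω, fun i => V p.1 p.2 i ω)) μ

/-! ### Differential privacy -/

/-- `(ε, δ)`-differential privacy of a randomized mechanism `F`, whose output on the database `X`
is the random variable `F X`, with respect to the adjacency relation `Adj`. -/
def IsDP {𝒳 Ω 𝒴 : Type*} [MeasurableSpace Ω] [MeasurableSpace 𝒴] (Adj : 𝒳 → 𝒳 → Prop)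
    (μ : Measure Ω) (F : 𝒳 → Ω → 𝒴) (ε δ : ℝ) : Prop :=
  ∀ X X' : 𝒳, Adj X X' → ∀ T : Set 𝒴, MeasurableSet T →
    μ.real {ω | F X ω ∈ T} ≤ Real.exp ε * μ.real {ω | F X' ω ∈ T} + δ

/-- The collections of local datasets `D`, `D'` differ in (at most) one entry, of client `k`. -/
def AdjClient {𝒰 : Type*} {K : ℕ} {N : Fin K → ℕ} (k : Fin K) (D D' : ∀ k, Fin (N k) → 𝒰) :
    Prop :=
  ∃ (i : Fin (N k)) (x : 𝒰), D' = Function.update D k (Function.update (D k) i x)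

/-- The standard Gaussian cdf. -/
def Phi (x : ℝ) : ℝ := cdf (gaussianReal 0 1) x

/-- `log (1 + p (e^ε' - 1))` with `p = 1 - (1 - 1/n)^τ`. -/
def privacyEps (n τ : ℕ) (ε' : ℝ) : ℝ :=
  Real.log (1 + (1 - (1 - 1 / (n : ℝ)) ^ τ) * (Real.exp ε' - 1))

/-- The privacy relaxation of one round, for a client with `n` data. -/
def privacyDelta (K n τ : ℕ) (γ σ ε' : ℝ) : ℝ :=
  ∑ j ∈ Finset.Icc 1 τ, (τ.choose j : ℝ) * (1 / (n : ℝ)) ^ j * (1 - 1 / (n : ℝ)) ^ (τ - j) *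
    ((Real.exp ε' - 1) / (Real.exp (ε' / j) - 1)) *
    (Phi (τ * γ / (√K * σ) - √K * ε' * σ / (2 * j * τ * γ)) -
      Real.exp (ε' / j) * Phi (-(τ * γ / (√K * σ)) - √K * ε' * σ / (2 * j * τ * γ)))

end CEPAM

end

noncomputable section

namespace CEPAM

/-! ### The lattice quantizer of a basic cell -/

section Quantizer

variable {d : ℕ} {G : Matrix (Fin d) (Fin d) ℝ} {P : Set (Vec d)}

/-! The error law. Lattice translates cut the cell into pieces, and dithered quantization only
shifts these pieces. So the unaccepted error is uniform on the cell whatever the input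
(`IsBasicCell.map_dithered_error`); after scaling it is uniform on `β u • P`. The first error that
falls in the ball of radius `σ √u`, a subset of `β u • P`, is then uniform on that ball
(`map_first_accepted`, `Setup.map_errorAt`). For `u ~ χ²_{d+2}` the factor `u^{d/2}` of the density
cancels the volume of the ball. What remains is `exp (-u/2)`, and integrating it over `u ≥ ‖z‖²/σ²`
gives the Gaussian density at `z` (`bind_uniformBallKernel`).

Independence and averaging. The conditional law of the pairs (latent value, error) given the
training randomness does not depend on that randomness, so the joint law is a product
(`IsRoundRandomness.hasLaw_errors`). Splitting and collecting are linear and adjoint to each other,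
so the averaged error is Gaussian with variance `σ²/K` by characteristic functions
(`hasLaw_average_collect`).

Privacy. For a fixed global model the output is a uniform mixture, over the sample indices, of
Gaussians centred at the averaged clipped updates (`output_real_eq`). If two runs differ in one
client only, clipping keeps the centres within `2γ/K`, however many local steps differ. A
Neyman–Pearson bound (`isotropicGaussian_le`) compares the two Gaussians. A sample meets the changed
entry with probability `p`; comparing the samples that meet it both with the same samples on the
other database and with samples that miss it gives the factor `1 + p (e^ε' - 1)` and the additive
term `p g`, where `g` is a Gaussian profile (`amplification`). The stated `δ` is larger than `p g`:
its binomial weights sum to `p`, and each term only enlarges the profile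
(`mul_gaussianProfile_le_privacyDelta`). -/

lemma latticePoint_neg (G : Matrix (Fin d) (Fin d) ℝ) (a : Fin d → ℤ) :
    latticePoint G (-a) = -latticePoint G a := by
  have h : (fun i => (((-a) i : ℤ) : ℝ)) = -fun i => (a i : ℝ) := by
    ext i; simp
  rw [latticePoint, latticePoint, h, Matrix.mulVec_neg, WithLp.toLp_neg]

lemma IsBasicCell.existsUnique_sub_mem (hP : IsBasicCell G P) (x : Vec d) :
    ∃! a : Fin d → ℤ, latticePoint G a - x ∈ P := by
  obtain ⟨a, ha, hu⟩ := hP.partition (-x)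
  refine ⟨-a, ?_, fun b hb => ?_⟩
  · simpa [latticePoint_neg, sub_eq_add_neg, add_comm] using ha
  · have : -b = a := hu (-b) (by
      simpa [latticePoint_neg, sub_eq_add_neg, add_comm] using hb)
    rw [← this, neg_neg]

lemma IsBasicCell.latticeQuantizer_eq (hP : IsBasicCell G P) {x : Vec d} {a : Fin d → ℤ}
    (h : latticePoint G a - x ∈ P) : latticeQuantizer G P x = latticePoint G a := by
  have hex : ∃ a : Fin d → ℤ, latticePoint G a - x ∈ P := ⟨a, h⟩
  rw [latticeQuantizer, dif_pos hex]
  exact congrArg _ ((hP.existsUnique_sub_mem x).unique hex.choose_spec h)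

lemma IsBasicCell.measurable_latticeQuantizer (hP : IsBasicCell G P) (hm : MeasurableSet P) :
    Measurable (latticeQuantizer G P) := by
  choose a ha hu using fun x => hP.existsUnique_sub_mem x
  have hQ : latticeQuantizer G P = latticePoint G ∘ a := by
    ext1 x
    exact hP.latticeQuantizer_eq (ha x)
  rw [hQ]
  refine (measurable_of_countable _).comp (measurable_to_countable' fun b => ?_)
  have : a ⁻¹' {b} = (fun x => latticePoint G b - x) ⁻¹' P := by
    ext x
    simp only [Set.mem_preimage, Set.mem_singleton_iff]
    exact ⟨fun h => h ▸ ha x, fun h => (hu x b h).symm⟩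
  rw [this]
  exact hm.preimage (by fun_prop)

/-- The error of the dithered quantizer is uniform on the cell, whatever the input. -/
lemma IsBasicCell.map_dithered_error (hP : IsBasicCell G P) (hm : MeasurableSet P) (y : Vec d) :
    (volume[|P]).map (fun v => latticeQuantizer G P (y - v) + v - y) = volume[|P] := by
  have hf : Measurable fun v : Vec d => latticeQuantizer G P (y - v) + v - y :=
    (((hP.measurable_latticeQuantizer hm).comp (measurable_const.sub measurable_id)).add
      measurable_id).sub measurable_const
  ext A hA
  rw [Measure.map_apply hf hA, cond_apply hm, cond_apply hm]
  congr 1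
  let c : (Fin d → ℤ) → Vec d := fun a => latticePoint G a - y
  have hc : ∀ v a, latticePoint G a - (y - v) = c a + v := fun v a => by simp only [c]; abel
  -- Split the dithers by the index `a` of the lattice point that quantizes `y - v`; on that piece
  -- the error is the translate `c a + v`.
  have h1 : P ∩ (fun v => latticeQuantizer G P (y - v) + v - y) ⁻¹' A =
      ⋃ a, (fun v => c a + v) ⁻¹' ((P ∩ A) ∩ (fun z => -c a + z) ⁻¹' P) := by
    ext v
    simp only [Set.mem_inter_iff, Set.mem_preimage, Set.mem_iUnion, neg_add_cancel_left]
    constructor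
    · rintro ⟨hv, hA⟩
      obtain ⟨a, ha, -⟩ := hP.existsUnique_sub_mem (y - v)
      rw [hP.latticeQuantizer_eq ha] at hA
      rw [hc] at ha
      refine ⟨a, ⟨ha, ?_⟩, hv⟩
      convert hA using 1
      simp only [c]; abel
    · rintro ⟨a, ⟨ha, hA⟩, hv⟩
      refine ⟨hv, ?_⟩
      rw [← hc] at ha
      rw [hP.latticeQuantizer_eq ha]
      convert hA using 1
      simp only [c]; abel
  -- The translated pieces again partition `P ∩ A`, now because each `z + y` lies in exactly one
  -- translate of the cell.
  have h2 : P ∩ A = ⋃ a, (P ∩ A) ∩ (fun z => -c a + z) ⁻¹' P := by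
    rw [← Set.inter_iUnion]
    refine (Set.inter_eq_left.2 fun z _ => ?_).symm
    obtain ⟨a, ha, -⟩ := hP.partition (z + y)
    refine Set.mem_iUnion.2 ⟨a, ?_⟩
    simp only [Set.mem_preimage, c]
    convert ha using 1; abel
  have hms : ∀ a, MeasurableSet ((P ∩ A) ∩ (fun z => -c a + z) ⁻¹' P) := fun a =>
    (hm.inter hA).inter (hm.preimage (by fun_prop))
  rw [h1, measure_iUnion _ fun a => (hms a).preimage (by fun_prop)]
  · conv_rhs => rw [h2, measure_iUnion (fun a b hab => by
      refine Set.disjoint_left.2 fun z hz hz' => hab ?_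
      refine (hP.partition (z + y)).unique ?_ ?_
      · have := hz.2; simp only [Set.mem_preimage, c] at this
        convert this using 1; abel
      · have := hz'.2; simp only [Set.mem_preimage, c] at this
        convert this using 1; abel) hms]
    exact tsum_congr fun a => measure_preimage_add _ _ _
  · intro a b hab
    refine Set.disjoint_left.2 fun v hv hv' => hab ?_
    refine (hP.existsUnique_sub_mem (y - v)).unique ?_ ?_
    · rw [hc]; exact hv.1.1
    · rw [hc]; exact hv'.1.1

end Quantizer

/-! ### Rejection sampling -/

lemma measurable_natSInf {Ω : Type*} [MeasurableSpace Ω] {p : ℕ → Ω → Prop}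
    (hp : ∀ i, MeasurableSet {ω | p i ω}) : Measurable fun ω => sInf {i | p i ω} := by
  refine measurable_to_countable' fun n => ?_
  -- The second set accounts for `sInf ∅ = 0`: the value `0` also occurs when no index satisfies
  -- `p`.
  have : (fun ω => sInf {i | p i ω}) ⁻¹' {n} =
      ({ω | p n ω} ∩ ⋂ k : Fin n, {ω | p k ω}ᶜ) ∪ ({_ω | n = 0} ∩ ⋂ k, {ω | p k ω}ᶜ) := by
    ext ω
    simp only [Set.mem_preimage, Set.mem_singleton_iff, Set.mem_union, Set.mem_inter_iff,
      Set.mem_ofPred_eq, Set.mem_iInter, Set.mem_compl_iff]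
    constructor
    · rintro rfl
      rcases Set.eq_empty_or_nonempty {i | p i ω} with h | h
      · right
        refine ⟨by rw [h, Nat.sInf_empty], fun i hi => ?_⟩
        exact (Set.ext_iff.1 h i).1 hi
      · exact Or.inl ⟨Nat.sInf_mem h, fun k => Nat.notMem_of_lt_sInf k.2⟩
    · rintro (⟨h, hk⟩ | ⟨rfl, h⟩)
      · refine le_antisymm (Nat.sInf_le h) (not_lt.1 fun hlt => ?_)
        exact hk ⟨_, hlt⟩ (Nat.sInf_mem (s := {i | p i ω}) ⟨n, h⟩)
      · rw [show {i | p i ω} = ∅ from Set.eq_empty_iff_forall_notMem.2 h, Nat.sInf_empty]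
  rw [this]
  exact ((hp n).inter (.iInter fun k : Fin n => (hp k).compl)).union
    ((MeasurableSet.const _).inter (.iInter fun k => (hp k).compl))

lemma measurable_apply_natIndex {Ω α : Type*} [MeasurableSpace Ω] [MeasurableSpace α]
    {E : ℕ → Ω → α} {h : Ω → ℕ} (hE : ∀ i, Measurable (E i)) (hh : Measurable h) :
    Measurable fun ω => E (h ω) ω :=
  (measurable_from_prod_countable_right hE : Measurable fun q : ℕ × Ω => E q.1 q.2).comp
    (hh.prodMk measurable_id)

/-- Two probability measures are equal if one dominates the other. -/
lemma measure_eq_of_prob_le {α : Type*} [MeasurableSpace α] {μ ν : Measure α}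
    [IsProbabilityMeasure μ] [IsProbabilityMeasure ν]
    (h : ∀ B, MeasurableSet B → μ B ≤ ν B) : μ = ν := by
  refine Measure.eq_of_le_of_measure_univ_eq (Measure.le_iff.2 h) (by simp)

/-- The first member of an i.i.d. sequence that lies in `A` has the conditional law given `A`. -/
lemma map_first_accepted {Ω α : Type*} [MeasurableSpace Ω] [MeasurableSpace α] {μ : Measure Ω}
    [IsProbabilityMeasure μ] {E : ℕ → Ω → α} {ρ : Measure α} {A : Set α}
    (hE : ∀ i, Measurable (E i)) (hlaw : ∀ i, μ.map (E i) = ρ) (hind : iIndepFun E μ)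
    (hA : MeasurableSet A) (hρA : ρ A ≠ 0) :
    μ.map (fun ω => E (sInf {i | E i ω ∈ A}) ω) = ρ[|A] := by
  have : IsProbabilityMeasure ρ := hlaw 0 ▸ Measure.isProbabilityMeasure_map (hE 0).aemeasurable
  have hpre : ∀ i B, MeasurableSet B → μ (E i ⁻¹' B) = ρ B := fun i B hB => by
    rw [← hlaw i, Measure.map_apply (hE i) hB]
  have hmeas : Measurable fun ω => E (sInf {i | E i ω ∈ A}) ω :=
    measurable_apply_natIndex hE (measurable_natSInf fun i => hE i hA)
  have := Measure.isProbabilityMeasure_map (μ := μ) hmeas.aemeasurable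
  have := cond_isProbabilityMeasure hρA
  -- Between probability measures one inequality suffices, so the null event of no acceptance, where
  -- the index defaults to `0`, needs no treatment.
  refine (measure_eq_of_prob_le fun B hB => ?_).symm
  rw [Measure.map_apply hmeas hB, cond_apply hA]
  -- `C n` below is the event that the first `n` members are rejected and member `n` lies in `A ∩
  -- B`; its probabilities form a geometric series.
  let S : ℕ → ℕ → Set α := fun n k => if k = n then A ∩ B else Aᶜ
  have hS : ∀ n k, MeasurableSet (S n k) := fun n k => by
    dsimp only [S]; split_ifs
    exacts [hA.inter hB, hA.compl]
  let C : ℕ → Set Ω := fun n => ⋂ k ∈ Finset.range (n + 1), E k ⁻¹' S n k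
  have hCmem : ∀ n ω, ω ∈ C n → (E n ω ∈ A ∧ E n ω ∈ B) ∧ ∀ k < n, E k ω ∉ A := by
    intro n ω hω
    simp only [C, Set.mem_iInter, Finset.mem_range, Set.mem_preimage] at hω
    constructor
    · simpa [S] using hω n (Nat.lt_succ_self n)
    · intro k hk
      have := hω k (by omega)
      simpa [S, hk.ne] using this
  have hCm : ∀ n, MeasurableSet (C n) := fun n =>
    Finset.measurableSet_biInter _ fun k _ => hE k (hS n k)
  have hC : ∀ n, μ (C n) = (ρ Aᶜ) ^ n * ρ (A ∩ B) := by
    intro n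
    rw [hind.measure_inter_preimage_eq_mul _ (fun k _ => hS n k), Finset.prod_range_succ,
      Finset.prod_congr rfl (g := fun _ => ρ Aᶜ) (fun k hk => ?_), Finset.prod_const,
      Finset.card_range, hpre _ _ (hS n n)]
    · simp [S]
    · rw [hpre _ _ (hS n k)]
      simp [S, (Finset.mem_range.1 hk).ne]
  have hdisj : Pairwise fun i j => Disjoint (C i) (C j) := by
    intro i j hij
    refine Set.disjoint_left.2 fun ω hi hj => ?_
    rcases lt_or_gt_of_ne hij with h | h
    · exact (hCmem j ω hj).2 i h (hCmem i ω hi).1.1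
    · exact (hCmem i ω hi).2 j h (hCmem j ω hj).1.1
  calc (ρ A)⁻¹ * ρ (A ∩ B) = ∑' n, μ (C n) := by
        simp_rw [hC, ENNReal.tsum_mul_right, ENNReal.tsum_geometric, prob_compl_eq_one_sub hA]
        rw [ENNReal.sub_sub_cancel ENNReal.one_ne_top prob_le_one]
    _ = μ (⋃ n, C n) := (measure_iUnion hdisj hCm).symm
    _ ≤ _ := by
        refine measure_mono (Set.iUnion_subset fun n ω hω => ?_)
        obtain ⟨⟨h1, h2⟩, h3⟩ := hCmem n ω hω
        have : sInf {i | E i ω ∈ A} = n := by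
          refine le_antisymm (Nat.sInf_le h1) (not_lt.1 fun hlt => ?_)
          exact h3 _ hlt (Nat.sInf_mem (s := {i | E i ω ∈ A}) ⟨n, h1⟩)
        simpa [this] using h2

/-! ### Isotropic Gaussian measures -/

section Gaussian

variable {m : ℕ}

lemma posSemidef_smul_one (m : ℕ) {c : ℝ} (hc : 0 ≤ c) :
    (c • (1 : Matrix (Fin m) (Fin m) ℝ)).PosSemidef :=
  Matrix.PosSemidef.one.smul hc

lemma charFun_isotropicGaussian (a : Vec m) {c : ℝ} (hc : 0 ≤ c) (t : Vec m) :
    charFun (multivariateGaussian a (c • 1)) t =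
      Complex.exp (inner ℝ t a * Complex.I - c * ‖t‖ ^ 2 / 2) := by
  rw [charFun_multivariateGaussian (posSemidef_smul_one m hc)]
  congr 2
  rw [Matrix.smul_mulVec, Matrix.one_mulVec, dotProduct_smul]
  have : (t : Fin m → ℝ) ⬝ᵥ t = ‖t‖ ^ 2 := by
    rw [EuclideanSpace.real_norm_sq_eq]; simp [dotProduct, sq]
  rw [this]
  simp

lemma map_add_isotropicGaussian (a b : Vec m) {c : ℝ} (hc : 0 ≤ c) :
    (multivariateGaussian b (c • 1)).map (a + ·) = multivariateGaussian (a + b) (c • 1) := by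
  have := Measure.isProbabilityMeasure_map (μ := multivariateGaussian b (c • 1))
    (f := (a + ·)) (by fun_prop)
  refine Measure.ext_of_charFun (funext fun t => ?_)
  rw [charFun_map_const_add, charFun_isotropicGaussian _ hc, charFun_isotropicGaussian _ hc,
    ← Complex.exp_add, inner_add_right, real_inner_comm a t]
  congr 1
  push_cast
  ring

lemma integrable_gaussian (m : ℕ) {s : ℝ} (hs : 0 < s) :
    Integrable (fun z : Vec m => Real.exp (-‖z‖ ^ 2 / (2 * s ^ 2))) := by
  have h := GaussianFourier.integrable_cexp_neg_mul_sq_norm_add (V := Vec m)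
    (b := ((1 / (2 * s ^ 2) : ℝ) : ℂ)) (by rw [Complex.ofReal_re]; positivity) 0 0
  refine h.re.congr (ae_of_all _ fun z => ?_)
  have : -((1 / (2 * s ^ 2) : ℝ) : ℂ) * (‖z‖ : ℂ) ^ 2 + 0 * ((inner ℝ (0 : Vec m) z : ℝ) : ℂ) =
      ((-‖z‖ ^ 2 / (2 * s ^ 2) : ℝ) : ℂ) := by
    push_cast; ring
  simp only [this, ← Complex.ofReal_exp]
  exact Complex.ofReal_re _

/-- The unnormalized centred Gaussian measure. -/
def gaussianWeight (m : ℕ) (s : ℝ) : Measure (Vec m) :=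
  volume.withDensity fun z => ENNReal.ofReal (Real.exp (-‖z‖ ^ 2 / (2 * s ^ 2)))

lemma gaussianWeight_univ (m : ℕ) {s : ℝ} (hs : 0 < s) :
    gaussianWeight m s Set.univ =
      ENNReal.ofReal (∫ z : Vec m, Real.exp (-‖z‖ ^ 2 / (2 * s ^ 2))) := by
  rw [gaussianWeight, withDensity_apply _ .univ, Measure.restrict_univ,
    ofReal_integral_eq_lintegral_ofReal (integrable_gaussian m hs)
      (ae_of_all _ fun z => (Real.exp_pos _).le)]

lemma gaussianWeight_univ_ne_zero (m : ℕ) {s : ℝ} (hs : 0 < s) :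
    gaussianWeight m s Set.univ ≠ 0 := by
  rw [gaussianWeight_univ m hs, Ne, ENNReal.ofReal_eq_zero, not_le]
  exact integral_exp_pos (integrable_gaussian m hs)

/-- A centred isotropic Gaussian measure is its unnormalized version divided by the mass. -/
lemma isotropicGaussian_eq_smul (m : ℕ) {s : ℝ} (hs : 0 < s) :
    multivariateGaussian (0 : Vec m) (s ^ 2 • 1) =
      (gaussianWeight m s Set.univ)⁻¹ • gaussianWeight m s := by
  have h0 := gaussianWeight_univ_ne_zero m hs
  have htop : gaussianWeight m s Set.univ ≠ ⊤ := by
    rw [gaussianWeight_univ m hs]; exact ENNReal.ofReal_ne_top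
  have : IsProbabilityMeasure ((gaussianWeight m s Set.univ)⁻¹ • gaussianWeight m s) :=
    ⟨by rw [Measure.smul_apply, smul_eq_mul, ENNReal.inv_mul_cancel h0 htop]⟩
  refine Measure.ext_of_charFun (funext fun t => ?_)
  set b : ℂ := ((1 / (2 * s ^ 2) : ℝ) : ℂ) with hb
  have hbpos : 0 < b.re := by rw [hb, Complex.ofReal_re]; positivity
  have hI := GaussianFourier.integral_cexp_neg_mul_sq_norm_add (V := Vec m) hbpos Complex.I t
  have hI0 := GaussianFourier.integral_cexp_neg_mul_sq_norm (V := Vec m) hbpos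
  have hreal : ∫ v : Vec m, Complex.exp (-b * ‖v‖ ^ 2) =
      ((∫ z : Vec m, Real.exp (-‖z‖ ^ 2 / (2 * s ^ 2)) : ℝ) : ℂ) := by
    rw [← integral_complex_ofReal]
    congr 1; ext z
    rw [Complex.ofReal_exp, hb]
    push_cast; ring_nf
  rw [charFun_isotropicGaussian _ (sq_nonneg s), charFun_apply, integral_smul_measure,
    gaussianWeight, integral_withDensity_eq_integral_toReal_smul (by fun_prop)
      (ae_of_all _ fun z => ENNReal.ofReal_lt_top), ← gaussianWeight, gaussianWeight_univ m hs]
  have h3 : (fun z : Vec m => (ENNReal.ofReal (Real.exp (-‖z‖ ^ 2 / (2 * s ^ 2)))).toReal •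
      Complex.exp ((inner ℝ z t : ℝ) * Complex.I)) =
      fun z => Complex.exp (-b * ‖z‖ ^ 2 + Complex.I * (inner ℝ t z : ℝ)) := by
    ext z
    rw [ENNReal.toReal_ofReal (Real.exp_pos _).le, Complex.real_smul, Complex.ofReal_exp,
      ← Complex.exp_add, real_inner_comm, hb]
    congr 1; push_cast; ring
  -- The prefactor of the Fourier transform is turned back into the integral at `t = 0`, so it
  -- cancels against the mass without being evaluated.
  rw [h3, hI, ← hI0, hreal]
  have hpos : 0 < ∫ z : Vec m, Real.exp (-‖z‖ ^ 2 / (2 * s ^ 2)) :=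
    integral_exp_pos (integrable_gaussian m hs)
  rw [ENNReal.toReal_inv, ENNReal.toReal_ofReal hpos.le, Complex.real_smul, ← mul_assoc,
    ← Complex.ofReal_mul, inv_mul_cancel₀ hpos.ne', Complex.ofReal_one, one_mul, inner_zero_right]
  congr 1
  rw [hb, Complex.I_sq]
  have : (s : ℂ) ≠ 0 := Complex.ofReal_ne_zero.2 hs.ne'
  push_cast
  field_simp
  ring

end Gaussian

/-! ### The Gaussian law as a mixture of uniform laws on balls -/

section Mixture

variable {d : ℕ}

instance (r : ℕ) [NeZero r] : IsProbabilityMeasure (chiSquared r) :=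
  isProbabilityMeasure_gammaMeasure
    (by have := NeZero.pos r; positivity) (by norm_num)

/-- The kernel `u ↦ Unif (σ √u B)`. -/
def uniformBallKernel (d : ℕ) (σ : ℝ) (hσ : 0 ≤ σ) : Kernel ℝ (Vec d) where
  toFun u := volume[|Metric.closedBall 0 (σ * √u)]
  measurable' := by
    refine Measure.measurable_of_measurable_coe _ fun B hB => ?_
    have hmono : ∀ C : Set (Vec d),
        Measurable fun u : ℝ => volume (Metric.closedBall (0 : Vec d) (σ * √u) ∩ C) := by
      intro C
      refine Monotone.measurable fun u u' h => measure_mono (Set.inter_subset_inter_left _ ?_)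
      exact Metric.closedBall_subset_closedBall (by gcongr)
    simp_rw [cond_apply Metric.isClosed_closedBall.measurableSet]
    have h1 := hmono Set.univ
    simp only [Set.inter_univ] at h1
    exact h1.inv.mul (hmono B)

@[simp]
lemma uniformBallKernel_apply (σ : ℝ) (hσ : 0 ≤ σ) (u : ℝ) :
    uniformBallKernel d σ hσ u = volume[|Metric.closedBall 0 (σ * √u)] := rfl

/-- Not a Markov kernel in general: for `u ≤ 0` the ball is a single point, and conditioning on this
null set (when `d > 0`) gives the zero measure. -/
instance (σ : ℝ) (hσ : 0 ≤ σ) : IsFiniteKernel (uniformBallKernel d σ hσ) :=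
  ⟨1, ENNReal.one_lt_top, fun u => by rw [uniformBallKernel_apply]; exact prob_le_one⟩

lemma measurable_gammaPDF (a r : ℝ) : Measurable (gammaPDF a r) :=
  (measurable_gammaPDFReal a r).ennreal_ofReal

/-- The conditions on `β` and the layers are only assumed for `u > 0`; this makes them available
almost surely. -/
lemma chiSquared_ae_pos (r : ℕ) : ∀ᵐ u ∂(chiSquared r), 0 < u := by
  rw [chiSquared, gammaMeasure, ae_withDensity_iff (measurable_gammaPDF _ _)]
  have h0 : ∀ᵐ u : ℝ, u ≠ 0 := by simp [ae_iff]
  filter_upwards [h0] with u hu hne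
  rcases lt_or_gt_of_ne hu with h | h
  · exact absurd (gammaPDF_of_neg h) hne
  · exact h

lemma volume_closedBall_ne_zero {r : ℝ} (hr : 0 < r) :
    volume (Metric.closedBall (0 : Vec d) r) ≠ 0 :=
  (Metric.measure_closedBall_pos volume 0 hr).ne'

lemma volume_closedBall_ne_top {r : ℝ} : volume (Metric.closedBall (0 : Vec d) r) ≠ ⊤ :=
  measure_closedBall_lt_top.ne

/-- This is where `d + 2` degrees of freedom matter: the density then carries `u ^ (d / 2)`, exactly
the power in the volume of the ball of radius `σ √u`. -/
lemma gammaPDF_mul_volume_inv {σ : ℝ} (hσ : 0 < σ) : ∃ C : ENNReal, ∀ u : ℝ, 0 < u →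
    gammaPDF (((d + 2 : ℕ) : ℝ) / 2) (1 / 2) u *
      (volume (Metric.closedBall (0 : Vec d) (σ * √u)))⁻¹ =
        C * ENNReal.ofReal (Real.exp (-u / 2)) := by
  set a : ℝ := ((d + 2 : ℕ) : ℝ) / 2 with ha
  set k : ℝ := (1 / 2) ^ a / Real.Gamma a
  refine ⟨ENNReal.ofReal k * (ENNReal.ofReal (σ ^ d))⁻¹ *
    (volume (Metric.ball (0 : Vec d) 1))⁻¹, fun u hu => ?_⟩
  have hk : 0 ≤ k := div_nonneg (by positivity) (Real.Gamma_nonneg_of_nonneg (by positivity))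
  have hsu : 0 < √u := Real.sqrt_pos.2 hu
  have hpow : u ^ (a - 1) = √u ^ d := by
    rw [Real.sqrt_eq_rpow, ← Real.rpow_natCast, ← Real.rpow_mul hu.le, ha]
    congr 1; push_cast; ring
  rw [gammaPDF_of_nonneg hu.le, Measure.addHaar_closedBall _ _ (by positivity), finrank_euclideanSpace_fin,
    mul_pow, hpow, ENNReal.ofReal_mul (by positivity), ENNReal.ofReal_mul (by positivity),
    ENNReal.ofReal_mul (by positivity),
    ENNReal.mul_inv (Or.inr measure_ball_lt_top.ne)
      (Or.inr (Metric.measure_ball_pos volume 0 one_pos).ne'),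
    ENNReal.mul_inv (Or.inr ENNReal.ofReal_ne_top) (Or.inl ENNReal.ofReal_ne_top)]
  have hcancel : ENNReal.ofReal (√u ^ d) * (ENNReal.ofReal (√u ^ d))⁻¹ = 1 :=
    ENNReal.mul_inv_cancel (ENNReal.ofReal_pos.2 (pow_pos hsu d)).ne' ENNReal.ofReal_ne_top
  calc _ = ENNReal.ofReal k * (ENNReal.ofReal (σ ^ d))⁻¹ *
      (volume (Metric.ball (0 : Vec d) 1))⁻¹ * ENNReal.ofReal (Real.exp (-(1 / 2 * u))) *
      (ENNReal.ofReal (√u ^ d) * (ENNReal.ofReal (√u ^ d))⁻¹) := by ring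
    _ = _ := by rw [hcancel, mul_one]; congr 3; ring

/-- The point `z` belongs to the layer of `u` exactly when `u ≥ ‖z‖² / σ²`, so the integral is an
exponential tail; the endpoint is a null set. -/
lemma lintegral_exp_layer {σ : ℝ} (hσ : 0 < σ) (z : Vec d) :
    ∫⁻ u : ℝ, (if 0 < u ∧ ‖z‖ ≤ σ * √u then ENNReal.ofReal (Real.exp (-u / 2)) else 0) =
      2 * ENNReal.ofReal (Real.exp (-‖z‖ ^ 2 / (2 * σ ^ 2))) := by
  set c : ℝ := ‖z‖ ^ 2 / σ ^ 2
  have hc : 0 ≤ c := by positivity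
  have h1 : (fun u : ℝ => if 0 < u ∧ ‖z‖ ≤ σ * √u then ENNReal.ofReal (Real.exp (-u / 2)) else 0)
      =ᵐ[volume] (Set.Ioi c).indicator fun u => ENNReal.ofReal (Real.exp (-u / 2)) := by
    have h0 : ∀ᵐ u : ℝ, u ≠ c := by simp [ae_iff]
    filter_upwards [h0] with u hu
    rw [Set.indicator_apply]
    congr 1
    rw [eq_iff_iff, Set.mem_Ioi]
    have key : 0 < u → (‖z‖ ≤ σ * √u ↔ c ≤ u) := fun hu0 => by
      rw [mul_comm, ← div_le_iff₀ hσ, Real.le_sqrt (by positivity), div_pow]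
      exact hu0.le
    constructor
    · rintro ⟨h, h'⟩
      exact lt_of_le_of_ne ((key h).1 h') hu.symm
    · intro h
      exact ⟨hc.trans_lt h, (key (hc.trans_lt h)).2 h.le⟩
  have hint : IntegrableOn (fun u : ℝ => Real.exp (-u / 2)) (Set.Ioi c) := by
    have := integrableOn_exp_mul_Ioi (a := -(1 / 2)) (by norm_num) c
    refine this.congr_fun (fun u _ => ?_) measurableSet_Ioi
    simp only; congr 1; ring
  have hval : ∫ u in Set.Ioi c, Real.exp (-u / 2) = 2 * Real.exp (-c / 2) := by
    have := integral_exp_mul_Ioi (a := -(1 / 2)) (by norm_num) c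
    calc _ = ∫ u in Set.Ioi c, Real.exp (-(1 / 2) * u) := by
          congr 1; ext u; congr 1; ring
      _ = _ := by rw [this, show -(1 / 2) * c = -c / 2 by ring]; ring
  rw [lintegral_congr_ae h1, lintegral_indicator measurableSet_Ioi,
    ← ofReal_integral_eq_lintegral_ofReal hint (ae_of_all _ fun u => (Real.exp_pos _).le), hval,
    ENNReal.ofReal_mul (by norm_num), ENNReal.ofReal_ofNat]
  congr 3
  simp only [c]; field_simp

/-- The mixture of the uniform laws on `σ √u B`, with `u ~ χ²_{d+2}`, is Gaussian. -/
lemma bind_uniformBallKernel [NeZero d] {σ : ℝ} (hσ : 0 < σ) :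
    (chiSquared (d + 2)).bind (uniformBallKernel d σ hσ.le) =
      multivariateGaussian 0 (σ ^ 2 • 1) := by
  obtain ⟨C, hC⟩ := gammaPDF_mul_volume_inv (d := d) hσ
  set κ := uniformBallKernel d σ hσ.le with hκ
  have hprop : (chiSquared (d + 2)).bind κ = (C * 2) • gaussianWeight d σ := by
    ext B hB
    let F : ℝ → Vec d → ENNReal := fun u z =>
      if 0 < u ∧ ‖z‖ ≤ σ * √u then ENNReal.ofReal (Real.exp (-u / 2)) else 0
    have hF : Measurable (Function.uncurry F) := by
      have hexp : Measurable fun p : ℝ × Vec d => ENNReal.ofReal (Real.exp (-p.1 / 2)) := by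
        fun_prop
      refine Measurable.ite ?_ hexp measurable_const
      refine (measurableSet_lt measurable_const measurable_fst).inter
        (measurableSet_le (measurable_norm.comp measurable_snd) ?_)
      exact measurable_const.mul (Real.continuous_sqrt.measurable.comp measurable_fst)
    have h0 : ∀ᵐ u : ℝ, u ≠ 0 := by simp [ae_iff]
    rw [Measure.bind_apply hB κ.measurable.aemeasurable, chiSquared, gammaMeasure,
      lintegral_withDensity_eq_lintegral_mul _ (measurable_gammaPDF _ _)
        (κ.measurable_coe hB)]
    calc _ = ∫⁻ u : ℝ, ∫⁻ z in B, C * F u z := by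
          refine lintegral_congr_ae ?_
          filter_upwards [h0] with u hu
          rcases lt_or_gt_of_ne hu with h | h
          · simp only [Pi.mul_apply]
            rw [gammaPDF_of_neg h]
            simp [F, not_lt.2 h.le]
          · simp only [Pi.mul_apply]
            rw [hκ, uniformBallKernel_apply,
              cond_apply Metric.isClosed_closedBall.measurableSet, ← mul_assoc, hC u h]
            have : (fun z => C * F u z) = (Metric.closedBall (0 : Vec d) (σ * √u)).indicator
                fun _ => C * ENNReal.ofReal (Real.exp (-u / 2)) := by
              ext z
              classical
              rw [Set.indicator_apply]
              simp only [F, h, true_and, mem_closedBall_zero_iff, mul_ite, mul_zero]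
            rw [this, lintegral_indicator Metric.isClosed_closedBall.measurableSet,
              setLIntegral_const, Measure.restrict_apply Metric.isClosed_closedBall.measurableSet]
      _ = ∫⁻ z in B, ∫⁻ u : ℝ, C * F u z :=
          lintegral_lintegral_swap (hF.const_mul C).aemeasurable
      _ = ∫⁻ z in B, C * (2 * ENNReal.ofReal (Real.exp (-‖z‖ ^ 2 / (2 * σ ^ 2)))) := by
          refine lintegral_congr fun z => ?_
          have hFz : Measurable fun u => F u z := hF.comp measurable_prodMk_right
          rw [lintegral_const_mul _ hFz, ← lintegral_exp_layer hσ z]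
      _ = _ := by
          rw [Measure.smul_apply, gaussianWeight, withDensity_apply _ hB, smul_eq_mul,
            ← lintegral_const_mul _ (by fun_prop)]
          simp_rw [mul_assoc]
  -- The constant `C` is never computed: total mass one identifies it with the Gaussian
  -- normalization.
  have hmass : (chiSquared (d + 2)).bind κ Set.univ = 1 := by
    rw [Measure.bind_apply .univ κ.measurable.aemeasurable,
      lintegral_congr_ae (g := fun _ => 1), lintegral_one, measure_univ]
    filter_upwards [chiSquared_ae_pos (d + 2)] with u hu
    rw [hκ, uniformBallKernel_apply]
    have := cond_isProbabilityMeasure_of_finite (μ := (volume : Measure (Vec d)))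
      (volume_closedBall_ne_zero (d := d) (mul_pos hσ (Real.sqrt_pos.2 hu)))
      volume_closedBall_ne_top
    exact measure_univ
  rw [hprop, Measure.smul_apply, smul_eq_mul] at hmass
  rw [hprop, isotropicGaussian_eq_smul d hσ, ENNReal.eq_inv_of_mul_eq_one_left hmass]

end Mixture

/-! ### Conditionally specified laws -/

section Kernel

variable {Ω α β γ : Type*} [MeasurableSpace Ω] [MeasurableSpace α] [MeasurableSpace β]
  [MeasurableSpace γ] {μ : Measure Ω} [IsProbabilityMeasure μ]

/-- If `T` and `R` are independent and `g (t, R)` has law `κ t` for almost every `t`, then `κ` is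
the conditional law of `g (T, R)` given `T`. -/
lemma map_prodMk_eq_compProd {T : Ω → α} {R : Ω → β} (hT : Measurable T) (hR : Measurable R)
    (hTR : IndepFun T R μ) {g : α × β → γ} (hg : Measurable g) {κ : Kernel α γ} [IsSFiniteKernel κ]
    (h : ∀ᵐ t ∂(μ.map T), μ.map (fun ω => g (t, R ω)) = κ t) :
    μ.map (fun ω => (T ω, g (T ω, R ω))) = μ.map T ⊗ₘ κ := by
  have := Measure.isProbabilityMeasure_map (μ := μ) hT.aemeasurable
  have := Measure.isProbabilityMeasure_map (μ := μ) hR.aemeasurable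
  have hf : Measurable fun q : α × β => (q.1, g q) := measurable_fst.prodMk hg
  ext s hs
  have : (fun ω => (T ω, g (T ω, R ω))) = (fun q : α × β => (q.1, g q)) ∘ fun ω => (T ω, R ω) := rfl
  rw [this, ← Measure.map_map hf (hT.prodMk hR),
    hTR.map_prod_eq_prod_map_map hT.aemeasurable hR.aemeasurable, Measure.map_apply hf hs,
    Measure.prod_apply (hf hs), Measure.compProd_apply hs]
  refine lintegral_congr_ae ?_
  filter_upwards [h] with t ht
  have hgt : Measurable fun r => g (t, r) := hg.comp measurable_prodMk_left
  have hst : MeasurableSet (Prod.mk t ⁻¹' s) := measurable_prodMk_left hs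
  rw [← ht, show (fun ω => g (t, R ω)) = (fun r => g (t, r)) ∘ R from rfl,
    Measure.map_apply (hgt.comp hR) hst,
    Measure.map_apply hR (measurable_prodMk_left (hf hs))]
  rfl

end Kernel

/-! ### Measurability of the local updates -/

lemma measurable_gradient {m : ℕ} (f : Vec m → ℝ) : Measurable (gradient f) :=
  (LinearIsometryEquiv.continuous _).measurable.comp (measurable_fderiv ℝ f)

lemma measurable_clip {m : ℕ} (γ : ℝ) : Measurable (clip γ : Vec m → Vec m) := by
  have h : Measurable fun x : Vec m => (max 1 (‖x‖ / γ))⁻¹ :=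
    (measurable_const.max (measurable_norm.div_const γ)).inv
  exact h.smul measurable_id

/-- Source of the sensitivity bound: it limits a client's whole update, however many of its local
steps use the changed entry. -/
lemma norm_clip_le {m : ℕ} {γ : ℝ} (hγ : 0 < γ) (x : Vec m) : ‖clip γ x‖ ≤ γ := by
  have hpos : 0 < max 1 (‖x‖ / γ) := lt_max_of_lt_left one_pos
  rw [clip, norm_smul, Real.norm_eq_abs, abs_of_pos (inv_pos.2 hpos), inv_mul_le_iff₀ hpos]
  calc ‖x‖ = ‖x‖ / γ * γ := by field_simp
    _ ≤ _ := mul_le_mul_of_nonneg_right (le_max_right _ _) hγ.le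

namespace Setup

variable {𝒰 : Type*} {m d τ : ℕ} (S : Setup 𝒰 m d τ)

lemma measurable_localSGD (ξ : Fin τ → 𝒰) : Measurable fun w => S.localSGD w ξ := by
  have : ∀ (n : ℕ) (step : Fin n → Vec m → Vec m), (∀ t, Measurable (step t)) →
      Measurable fun w => Fin.foldl n (fun w' t => step t w') w := by
    intro n
    induction n with
    | zero => intro step _; simpa using measurable_id'
    | succ n ih =>
      intro step hs
      simp only [Fin.foldl_succ]
      exact (ih _ fun t => hs t.succ).comp (hs 0)
  exact this τ (fun t w' => w' - S.η t • gradient (fun z => S.ℓ z (ξ t)) w') fun t => by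
      have hg : Measurable fun w' => S.η t • gradient (fun z => S.ℓ z (ξ t)) w' :=
        (measurable_gradient fun z => S.ℓ z (ξ t)).const_smul (S.η t)
      exact measurable_id.sub hg

lemma measurable_clippedUpdate (ξ : Fin τ → 𝒰) : Measurable fun w => S.clippedUpdate w ξ :=
  (measurable_clip _).comp ((S.measurable_localSGD ξ).sub measurable_id)

/-! ### Law of the quantization error -/

/-- The quantization error on one sub-vector. -/
def errorAt (x : Vec d) (u : ℝ) (v : ℕ → Vec d) : Vec d :=
  decodeSub S.β u v (encodeSub S.G S.P S.β (gaussianLayer d S.σ) x u v) - x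

/-- The error made if the dither `v` is used, whether or not it is accepted. -/
def candidateError (x : Vec d) (u : ℝ) (v : Vec d) : Vec d :=
  S.β u • (latticeQuantizer S.G S.P ((S.β u)⁻¹ • x - v) + v) - x

lemma measurable_candidateError :
    Measurable fun q : Vec d × ℝ × Vec d => S.candidateError q.1 q.2.1 q.2.2 := by
  have hβ : Measurable fun q : Vec d × ℝ × Vec d => S.β q.2.1 :=
    S.β_measurable.comp (measurable_fst.comp measurable_snd)
  have hv : Measurable fun q : Vec d × ℝ × Vec d => q.2.2 := measurable_snd.comp measurable_snd
  exact (hβ.smul (((S.P_cell.measurable_latticeQuantizer S.P_measurable).comp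
    ((hβ.inv.smul measurable_fst).sub hv)).add hv)).sub measurable_fst

lemma measurable_errorAt :
    Measurable fun q : Vec d × ℝ × (ℕ → Vec d) => S.errorAt q.1 q.2.1 q.2.2 := by
  have hE : ∀ i, Measurable fun q : Vec d × ℝ × (ℕ → Vec d) =>
      S.candidateError q.1 q.2.1 (q.2.2 i) := fun i =>
    S.measurable_candidateError.comp (measurable_fst.prodMk
      ((measurable_fst.comp measurable_snd).prodMk
        ((measurable_pi_apply i).comp (measurable_snd.comp measurable_snd))))
  have hA : ∀ i, MeasurableSet {q : Vec d × ℝ × (ℕ → Vec d) |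
      S.candidateError q.1 q.2.1 (q.2.2 i) ∈ gaussianLayer d S.σ q.2.1} := fun i => by
    simp only [gaussianLayer, mem_closedBall_zero_iff]
    exact measurableSet_le (hE i).norm (measurable_const.mul
      (Real.continuous_sqrt.measurable.comp (measurable_fst.comp measurable_snd)))
  -- By unfolding, `errorAt` is the candidate error at the first accepted index.
  exact measurable_apply_natIndex hE (measurable_natSInf hA)

/-- A zero scale would collapse the cell into the origin, while for `d > 0` the layer contains a
nonzero vector. -/
lemma β_ne_zero [NeZero d] {u : ℝ} (hu : 0 < u) : S.β u ≠ 0 := by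
  intro h0
  have hsub := S.layer_subset u hu
  rw [h0] at hsub
  have hr : 0 < S.σ * √u := mul_pos S.σ_pos (Real.sqrt_pos.2 hu)
  obtain ⟨x, hx⟩ := exists_norm_eq (Vec d) hr.le
  have hmem : x ∈ gaussianLayer d S.σ u := by
    simp [gaussianLayer, hx]
  obtain ⟨y, -, hy⟩ := hsub hmem
  have : x = 0 := by simpa using hy.symm
  rw [this, norm_zero] at hx
  exact hr.ne hx

/-- The Jacobian `|c| ^ d` occurs in both the volume of the set and that of the whole region, and
cancels. -/
lemma map_smul_cond {c : ℝ} (hc : c ≠ 0) {P : Set (Vec d)} (hP : MeasurableSet P) :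
    (volume[|P]).map (c • ·) = volume[|c • P] := by
  have hk : ENNReal.ofReal |c ^ Module.finrank ℝ (Vec d)| ≠ 0 := by
    simp [hc]
  have hcP : MeasurableSet (c • P) := hP.const_smul₀ c
  ext B hB
  rw [Measure.map_apply (measurable_const_smul c) hB, cond_apply hP, cond_apply hcP]
  have hB' : c • P ∩ B = c • (P ∩ (c • ·) ⁻¹' B) := by
    rw [Set.smul_set_inter₀ hc]
    congr 1
    exact (Set.image_preimage_eq B (MulAction.bijective₀ hc).surjective).symm
  rw [hB', Measure.addHaar_smul, Measure.addHaar_smul,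
    ENNReal.mul_inv (Or.inl hk) (Or.inl ENNReal.ofReal_ne_top), mul_mul_mul_comm,
    mul_comm _⁻¹, mul_comm _⁻¹, ENNReal.mul_inv_cancel hk ENNReal.ofReal_ne_top, one_mul, mul_comm]

/-- The candidate error is `β u` times the dithered error at the rescaled input, which is uniform on
the cell. -/
lemma map_candidateError [NeZero d] (x : Vec d) {u : ℝ} (hu : 0 < u) :
    (volume[|S.P]).map (S.candidateError x u) = volume[|S.β u • S.P] := by
  have hβ := S.β_ne_zero hu
  have : S.candidateError x u = (S.β u • ·) ∘ fun v =>
      latticeQuantizer S.G S.P ((S.β u)⁻¹ • x - v) + v - (S.β u)⁻¹ • x := by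
    ext1 v
    simp only [candidateError, Function.comp, smul_sub, smul_inv_smul₀ hβ]
  have hm : Measurable fun v =>
      latticeQuantizer S.G S.P ((S.β u)⁻¹ • x - v) + v - (S.β u)⁻¹ • x :=
    (((S.P_cell.measurable_latticeQuantizer S.P_measurable).comp
      (measurable_const.sub measurable_id)).add measurable_id).sub measurable_const
  rw [this, ← Measure.map_map (measurable_const_smul _) hm,
    S.P_cell.map_dithered_error S.P_measurable,
    map_smul_cond hβ S.P_measurable]

variable {Ω : Type*} [MeasurableSpace Ω] {μ : Measure Ω} [IsProbabilityMeasure μ]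

/-- Given the latent value, the quantization error is uniform on the layer, whatever the input. -/
lemma map_errorAt [NeZero d] {V : ℕ → Ω → Vec d} (hV : ∀ i, Measurable (V i))
    (hlaw : ∀ i, μ.map (V i) = volume[|S.P]) (hind : iIndepFun V μ) (x : Vec d) {u : ℝ}
    (hu : 0 < u) :
    μ.map (fun ω => S.errorAt x u fun i => V i ω) =
      volume[|Metric.closedBall 0 (S.σ * √u)] := by
  have hc : Measurable (S.candidateError x u) :=
    S.measurable_candidateError.comp (measurable_prodMk_left.comp measurable_prodMk_left)
  have hball : MeasurableSet (gaussianLayer d S.σ u) := Metric.isClosed_closedBall.measurableSet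
  have hPβ : MeasurableSet (S.β u • S.P) := S.P_measurable.const_smul₀ _
  have hfin : volume (S.β u • S.P) ≠ ⊤ :=
    (S.P_cell.bounded.smul₀ _).measure_lt_top.ne
  have h0 : volume (gaussianLayer d S.σ u) ≠ 0 :=
    volume_closedBall_ne_zero (mul_pos S.σ_pos (Real.sqrt_pos.2 hu))
  have hinter : S.β u • S.P ∩ gaussianLayer d S.σ u = gaussianLayer d S.σ u :=
    Set.inter_eq_right.2 (S.layer_subset u hu)
  have := map_first_accepted (μ := μ) (E := fun i ω => S.candidateError x u (V i ω))
    (ρ := volume[|S.β u • S.P]) (A := gaussianLayer d S.σ u) (fun i => hc.comp (hV i))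
    (fun i => by
      rw [← S.map_candidateError x hu, ← hlaw i, Measure.map_map hc (hV i)]; rfl)
    (hind.comp _ fun _ => hc) hball
    (by
      rw [cond_apply hPβ, hinter]
      exact mul_ne_zero (ENNReal.inv_ne_zero.2 hfin) h0)
  -- Conditioning the uniform law on `β u • P` to the ball it contains leaves the uniform law on the
  -- ball.
  rw [cond_cond_eq_cond_inter' hPβ hball hfin, hinter] at this
  exact this

/-- Joint law of the latent variable and the quantization error, for a fixed input. -/
lemma map_latent_errorAt [NeZero d] {U : Ω → ℝ} {V : ℕ → Ω → Vec d} (hU : Measurable U)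
    (hV : ∀ i, Measurable (V i)) (hUlaw : μ.map U = chiSquared (d + 2))
    (hlaw : ∀ i, μ.map (V i) = volume[|S.P]) (hind : iIndepFun V μ)
    (hUV : IndepFun U (fun ω i => V i ω) μ) (x : Vec d) :
    μ.map (fun ω => (U ω, S.errorAt x (U ω) fun i => V i ω)) =
      chiSquared (d + 2) ⊗ₘ uniformBallKernel d S.σ S.σ_pos.le := by
  rw [← hUlaw]
  refine map_prodMk_eq_compProd hU (measurable_pi_lambda _ hV) hUV
    (g := fun q : ℝ × (ℕ → Vec d) => S.errorAt x q.1 q.2)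
    (S.measurable_errorAt.comp measurable_prodMk_left) ?_
  rw [hUlaw]
  filter_upwards [chiSquared_ae_pos (d + 2)] with u hu
  exact S.map_errorAt hV hlaw hind x hu

end Setup

lemma snd_chiSquared_compProd {d : ℕ} [NeZero d] {σ : ℝ} (hσ : 0 < σ) :
    (chiSquared (d + 2) ⊗ₘ uniformBallKernel d σ hσ.le).snd =
      multivariateGaussian 0 (σ ^ 2 • 1) := by
  rw [Measure.snd_compProd, bind_uniformBallKernel hσ]

/-- The total mass is read off the Gaussian second marginal. -/
lemma isProbabilityMeasure_chiSquared_compProd {d : ℕ} [NeZero d] {σ : ℝ} (hσ : 0 < σ) :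
    IsProbabilityMeasure (chiSquared (d + 2) ⊗ₘ uniformBallKernel d σ hσ.le) :=
  ⟨by rw [← Measure.snd_univ, snd_chiSquared_compProd hσ, measure_univ]⟩

/-! ### Sub-vectors -/

section SubVec

variable {m d : ℕ}

lemma measurable_subVec (j : Fin (m ⌈/⌉ d)) : Measurable fun x : Vec m => subVec d x j := by
  refine (WithLp.measurable_toLp 2 _).comp (measurable_pi_lambda _ fun l => ?_)
  by_cases h : (j : ℕ) * d + l < m
  · simp only [h, dite_true]
    fun_prop
  · simp only [h, dite_false]
    exact measurable_const

variable [NeZero d]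

lemma collect_apply (y : Fin (m ⌈/⌉ d) → Vec d) (i : Fin m) :
    collect y i = y ⟨(i : ℕ) / d, div_lt_ceilDiv i (NeZero.pos d)⟩
      ⟨(i : ℕ) % d, Nat.mod_lt _ (NeZero.pos d)⟩ := rfl

lemma collect_subVec (x : Vec m) : collect (subVec d x) = x := by
  ext i
  have h : (i : ℕ) / d * d + (i : ℕ) % d = i := by rw [mul_comm]; exact Nat.div_add_mod _ _
  rw [collect_apply]
  simp [subVec, h]

lemma collect_add (y z : Fin (m ⌈/⌉ d) → Vec d) : collect (y + z) = collect y + collect z := rfl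

lemma measurable_collect : Measurable (collect : (Fin (m ⌈/⌉ d) → Vec d) → Vec m) := by
  refine (WithLp.measurable_toLp 2 _).comp (measurable_pi_lambda _ fun i => ?_)
  have h : ∀ l : Fin d, Measurable fun z : Vec d => z l := fun l => by fun_prop
  exact (h _).comp (measurable_pi_apply _)

/-- Collecting is the adjoint of splitting: the padded entries of `subVec d t` are zero, so whatever
`y` holds there does not contribute. -/
lemma inner_collect (y : Fin (m ⌈/⌉ d) → Vec d) (t : Vec m) :
    inner ℝ (collect y) t = ∑ j, inner ℝ (y j) (subVec d t j) := by
  simp only [PiLp.inner_apply, ← Fintype.sum_prod_type']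
  refine Finset.sum_of_injOn (fun i : Fin m =>
    ((⟨(i : ℕ) / d, div_lt_ceilDiv i (NeZero.pos d)⟩ : Fin (m ⌈/⌉ d)),
      (⟨(i : ℕ) % d, Nat.mod_lt _ (NeZero.pos d)⟩ : Fin d))) ?_ (by simp) ?_ ?_
  · intro i _ i' _ h
    simp only [Prod.mk.injEq, Fin.mk.injEq] at h
    ext
    rw [← Nat.div_add_mod (i : ℕ) d, ← Nat.div_add_mod (i' : ℕ) d, h.1, h.2]
  · rintro ⟨j, l⟩ - hjl
    have : ¬ ((j : ℕ) * d + l < m) := by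
      intro hlt
      refine hjl ⟨⟨(j : ℕ) * d + l, hlt⟩, by simp, ?_⟩
      have h1 : ((j : ℕ) * d + l) / d = j := by
        rw [mul_comm, Nat.mul_add_div (NeZero.pos d), Nat.div_eq_of_lt l.2, add_zero]
      have h2 : ((j : ℕ) * d + l) % d = l := by
        rw [mul_comm, Nat.mul_add_mod, Nat.mod_eq_of_lt l.2]
      ext <;> simp [h1, h2]
    simp [subVec, this]
  · intro i _
    have h : (i : ℕ) / d * d + (i : ℕ) % d = i := by rw [mul_comm]; exact Nat.div_add_mod _ _
    simp [subVec, h, collect_apply]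

lemma sum_norm_subVec_sq (t : Vec m) : ∑ j, ‖subVec d t j‖ ^ 2 = ‖t‖ ^ 2 := by
  simp only [← real_inner_self_eq_norm_sq]
  rw [← inner_collect, collect_subVec]

end SubVec

/-! ### Averages of Gaussian errors -/

/-- By adjointness, pairing with `t` gives a sum of independent terms over `(k, j)`. Each client
contributes `σ² ‖t‖² / K²` to the variance, and there are `K` clients. -/
lemma hasLaw_average_collect {Ω : Type*} [MeasurableSpace Ω] {μ : Measure Ω}
    [IsProbabilityMeasure μ] {K m d : ℕ} [NeZero K] [NeZero d] {σ : ℝ}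
    {Z : Fin K → Fin (m ⌈/⌉ d) → Ω → Vec d} (hZ : ∀ k j, Measurable (Z k j))
    (hlaw : ∀ k j, μ.map (Z k j) = multivariateGaussian 0 (σ ^ 2 • 1))
    (hind : iIndepFun (fun (p : Fin K × Fin (m ⌈/⌉ d)) => Z p.1 p.2) μ) :
    HasLaw (fun ω => (1 / (K : ℝ)) • ∑ k, collect fun j => Z k j ω)
      (multivariateGaussian 0 ((σ ^ 2 / K) • 1)) μ := by
  have hmeas : Measurable fun ω => (1 / (K : ℝ)) • ∑ k, collect fun j => Z k j ω :=
    (Finset.measurable_sum _ fun k _ =>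
      measurable_collect.comp (measurable_pi_lambda _ (hZ k))).const_smul (1 / (K : ℝ))
  have hK : (K : ℂ) ≠ 0 := Nat.cast_ne_zero.2 (NeZero.ne K)
  refine ⟨hmeas.aemeasurable, ?_⟩
  have := Measure.isProbabilityMeasure_map (μ := μ) hmeas.aemeasurable
  refine Measure.ext_of_charFun (funext fun t => ?_)
  rw [charFun_isotropicGaussian _ (by positivity), charFun_apply,
    integral_map hmeas.aemeasurable (by fun_prop)]
  have h1 : ∀ ω, Complex.exp ((inner ℝ ((1 / (K : ℝ)) • ∑ k, collect fun j => Z k j ω) t : ℝ) *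
      Complex.I) = ∏ p : Fin K × Fin (m ⌈/⌉ d), Complex.exp
        ((inner ℝ (Z p.1 p.2 ω) ((1 / (K : ℝ)) • subVec d t p.2) : ℝ) * Complex.I) := by
    intro ω
    rw [← Complex.exp_sum, ← Finset.sum_mul, ← Complex.ofReal_sum, Fintype.sum_prod_type,
      real_inner_smul_left, sum_inner, Finset.mul_sum]
    simp_rw [inner_collect, real_inner_smul_right, Finset.mul_sum]
  have h2 : ∀ p : Fin K × Fin (m ⌈/⌉ d), ∫ ω, Complex.exp
      ((inner ℝ (Z p.1 p.2 ω) ((1 / (K : ℝ)) • subVec d t p.2) : ℝ) * Complex.I) ∂μ =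
        Complex.exp ((-(σ ^ 2 * (1 / (K : ℝ)) ^ 2 * ‖subVec d t p.2‖ ^ 2 / 2) : ℝ)) := by
    intro p
    rw [← integral_map (f := fun z : Vec d => Complex.exp
      ((inner ℝ z ((1 / (K : ℝ)) • subVec d t p.2) : ℝ) * Complex.I)) (hZ p.1 p.2).aemeasurable
        (by fun_prop), hlaw, ← charFun_apply, charFun_isotropicGaussian _ (sq_nonneg σ),
      norm_smul, Real.norm_eq_abs, abs_of_nonneg (by positivity : 0 ≤ 1 / (K : ℝ)),
      inner_zero_right]
    congr 1
    push_cast; ring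
  simp_rw [h1]
  rw [hind.integral_fun_prod_comp (f := fun p z => Complex.exp
      ((inner ℝ z ((1 / (K : ℝ)) • subVec d t p.2) : ℝ) * Complex.I))
      (fun p => (hZ p.1 p.2).aemeasurable) (fun p => by fun_prop)]
  simp_rw [h2]
  rw [← Complex.exp_sum, ← Complex.ofReal_sum, Fintype.sum_prod_type]
  simp only
  rw [Finset.sum_neg_distrib, ← Finset.sum_div, ← Finset.mul_sum, sum_norm_subVec_sq,
    Finset.sum_const, Finset.card_univ, Fintype.card_fin, inner_zero_right]
  congr 1
  rw [nsmul_eq_mul]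
  push_cast
  field_simp
  ring

/-! ### One round -/

namespace IsRoundRandomness

variable {𝒰 Ω : Type*} [MeasurableSpace Ω] {μ : Measure Ω}
  {K m d τ : ℕ} {S : Setup 𝒰 m d τ} {N : Fin K → ℕ} {W : Ω → Vec m}
  {J : ∀ k, Fin τ → Ω → Fin (N k)} {U : Fin K → Fin (m ⌈/⌉ d) → Ω → ℝ}
  {V : Fin K → Fin (m ⌈/⌉ d) → ℕ → Ω → Vec d}

lemma measurable_shared (hR : IsRoundRandomness μ N S.P W J U V) :
    Measurable fun ω (p : Fin K × Fin (m ⌈/⌉ d)) => (U p.1 p.2 ω, fun i => V p.1 p.2 i ω) :=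
  measurable_pi_lambda _ fun _ => (hR.U_measurable _ _).prodMk
    (measurable_pi_lambda _ fun i => hR.V_measurable _ _ i)

lemma measurable_indices (hR : IsRoundRandomness μ N S.P W J U V) :
    Measurable fun ω k t => J k t ω :=
  measurable_pi_lambda _ fun k => measurable_pi_lambda _ fun t => hR.J_measurable k t

variable [IsProbabilityMeasure μ] [NeZero d]

/-- If the inputs of the quantizers are a function of a variable `T` that is independent of the
shared randomness, then the pairs (latent variable, error) are i.i.d. and independent of `T`. -/
lemma hasLaw_errors {α : Type*} [MeasurableSpace α] (hR : IsRoundRandomness μ N S.P W J U V)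
    {T : Ω → α} (hT : Measurable T)
    (hTR : IndepFun T
      (fun ω (p : Fin K × Fin (m ⌈/⌉ d)) => (U p.1 p.2 ω, fun i => V p.1 p.2 i ω)) μ)
    {x : α → Fin K → Vec m} (hx : ∀ k, Measurable fun t => x t k) :
    HasLaw (fun ω => (T ω, fun p : Fin K × Fin (m ⌈/⌉ d) => (U p.1 p.2 ω,
        S.subError (x (T ω) p.1) (fun j => U p.1 j ω) (fun j i => V p.1 j i ω) p.2)))
      ((μ.map T).prod (Measure.pi fun _ =>
        chiSquared (d + 2) ⊗ₘ uniformBallKernel d S.σ S.σ_pos.le)) μ := by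
  have := Measure.isProbabilityMeasure_map (μ := μ) hT.aemeasurable
  let g : α × (Fin K × Fin (m ⌈/⌉ d) → ℝ × (ℕ → Vec d)) → Fin K × Fin (m ⌈/⌉ d) → ℝ × Vec d :=
    fun q p => ((q.2 p).1, S.errorAt (subVec d (x q.1 p.1) p.2) (q.2 p).1 (q.2 p).2)
  have hg : Measurable g := by
    refine measurable_pi_lambda _ fun p => ?_
    have h2 : Measurable fun q : α × (Fin K × Fin (m ⌈/⌉ d) → ℝ × (ℕ → Vec d)) => q.2 p :=
      (measurable_pi_apply p).comp measurable_snd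
    exact (measurable_fst.comp h2).prodMk (S.measurable_errorAt.comp
      (((measurable_subVec p.2).comp ((hx p.1).comp measurable_fst)).prodMk h2))
  refine ⟨(hT.prodMk (hg.comp (hT.prodMk hR.measurable_shared))).aemeasurable, ?_⟩
  -- The product is a composition with a constant kernel: for every fixed `t` the law of the pairs
  -- must be shown to be the same.
  rw [← Measure.compProd_const]
  refine map_prodMk_eq_compProd hT hR.measurable_shared hTR hg (ae_of_all _ fun t => ?_)
  rw [Kernel.const_apply]
  have hgp : ∀ p : Fin K × Fin (m ⌈/⌉ d), Measurable fun r : ℝ × (ℕ → Vec d) =>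
      (r.1, S.errorAt (subVec d (x t p.1) p.2) r.1 r.2) := fun p =>
    measurable_fst.prodMk (S.measurable_errorAt.comp measurable_prodMk_left)
  have hind := hR.shared_indep.comp
    (fun (p : Fin K × Fin (m ⌈/⌉ d)) (r : ℝ × (ℕ → Vec d)) =>
      (r.1, S.errorAt (subVec d (x t p.1) p.2) r.1 r.2)) hgp
  refine (hind.hasLaw_pi fun p => ⟨?_, ?_⟩).map_eq
  · exact ((hgp p).comp ((measurable_pi_apply p).comp hR.measurable_shared)).aemeasurable
  · exact S.map_latent_errorAt (hR.U_measurable p.1 p.2) (hR.V_measurable p.1 p.2)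
      (hR.U_law p.1 p.2).map_eq (fun i => (hR.V_law p.1 p.2 i).map_eq) (hR.V_indep p.1 p.2)
      (hR.U_V_indep p.1 p.2) _

/-- The errors have the specified joint law with the latent variables, are independent of each
other, and together independent of `T`. -/
lemma errors_independent {α : Type*} [MeasurableSpace α] (hR : IsRoundRandomness μ N S.P W J U V)
    {T : Ω → α} (hT : Measurable T)
    (hTR : IndepFun T
      (fun ω (p : Fin K × Fin (m ⌈/⌉ d)) => (U p.1 p.2 ω, fun i => V p.1 p.2 i ω)) μ)
    {x : α → Fin K → Vec m} (hx : ∀ k, Measurable fun t => x t k)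
    {Z : Fin K → Fin (m ⌈/⌉ d) → Ω → Vec d}
    (hZ : Z = fun k j ω =>
      S.subError (x (T ω) k) (fun j => U k j ω) (fun j i => V k j i ω) j) :
    (∀ k j, Measurable (Z k j)) ∧
    (∀ k j, HasLaw (fun ω => (U k j ω, Z k j ω))
      (chiSquared (d + 2) ⊗ₘ uniformBallKernel d S.σ S.σ_pos.le) μ) ∧
    iIndepFun (fun (p : Fin K × Fin (m ⌈/⌉ d)) => Z p.1 p.2) μ ∧
    IndepFun (fun ω k j => Z k j ω) T μ := by
  have := isProbabilityMeasure_chiSquared_compProd (d := d) S.σ_pos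
  have := Measure.isProbabilityMeasure_map (μ := μ) hT.aemeasurable
  have hmain := hR.hasLaw_errors hT hTR hx
  have hUZ : HasLaw (fun ω (p : Fin K × Fin (m ⌈/⌉ d)) => (U p.1 p.2 ω, Z p.1 p.2 ω))
      (Measure.pi fun _ => chiSquared (d + 2) ⊗ₘ uniformBallKernel d S.σ S.σ_pos.le) μ := by
    rw [hZ]
    exact measurePreserving_snd.fun_comp_hasLaw hmain
  have hp : ∀ p : Fin K × Fin (m ⌈/⌉ d), HasLaw (fun ω => (U p.1 p.2 ω, Z p.1 p.2 ω))
      (chiSquared (d + 2) ⊗ₘ uniformBallKernel d S.σ S.σ_pos.le) μ := fun p =>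
    (measurePreserving_eval _ p).fun_comp_hasLaw hUZ
  refine ⟨fun k j => ?_, fun k j => hp (k, j), ?_, ?_⟩
  · rw [hZ]
    exact S.measurable_errorAt.comp (((measurable_subVec j).comp ((hx k).comp hT)).prodMk
      ((measurable_pi_apply (k, j)).comp hR.measurable_shared))
  · exact ((iIndepFun_iff_hasLaw_pi_pi hp).2 hUZ).comp (fun _ => Prod.snd)
      fun _ => measurable_snd
  · have hind := (indepFun_iff_hasLaw_prodMk_prod ⟨hT.aemeasurable, rfl⟩ hUZ).2
      (by rw [hZ]; exact hmain)
    have hψ : Measurable fun (q : Fin K × Fin (m ⌈/⌉ d) → ℝ × Vec d) k j => (q (k, j)).2 :=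
      measurable_pi_lambda _ fun k => measurable_pi_lambda _ fun j =>
        measurable_snd.comp (measurable_pi_apply (k, j))
    exact hind.symm.comp hψ measurable_id

end IsRoundRandomness

/-! ### Decoded average as clipped average plus Gaussian error -/

namespace Setup

variable {𝒰 : Type*} {m d τ : ℕ} (S : Setup 𝒰 m d τ)

/-- The clipped updates of all clients, as a function of the global model and the sample
indices. -/
def updates {K : ℕ} {N : Fin K → ℕ} (D : ∀ k, Fin (N k) → 𝒰) (w : Vec m)
    (j : ∀ k, Fin τ → Fin (N k)) (k : Fin K) : Vec m :=
  S.clippedUpdate w fun t => D k (j k t)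

lemma measurable_updates {K : ℕ} {N : Fin K → ℕ} (D : ∀ k, Fin (N k) → 𝒰) (k : Fin K) :
    Measurable fun q : Vec m × (∀ k, Fin τ → Fin (N k)) => S.updates D q.1 q.2 k := by
  have h : ∀ j : ∀ k, Fin τ → Fin (N k), Measurable fun w => S.updates D w j k :=
    fun j => S.measurable_clippedUpdate fun t => D k (j k t)
  exact measurable_from_prod_countable_left h

variable [NeZero d]

lemma estimate_eq (x : Vec m) (u : Fin (m ⌈/⌉ d) → ℝ) (v : Fin (m ⌈/⌉ d) → ℕ → Vec d) :
    S.estimate x u v = x + collect (S.subError x u v) := by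
  have h : S.decodedSub x u v = subVec d x + S.subError x u v :=
    funext fun j => (add_sub_cancel _ _).symm
  rw [estimate, h, collect_add, collect_subVec]

lemma average_estimate_eq {K : ℕ} (c : ℝ) (x : Fin K → Vec m) (u : Fin K → Fin (m ⌈/⌉ d) → ℝ)
    (v : Fin K → Fin (m ⌈/⌉ d) → ℕ → Vec d) :
    c • ∑ k, S.estimate (x k) (u k) (v k) =
      c • ∑ k, x k + c • ∑ k, collect (S.subError (x k) (u k) (v k)) := by
  simp_rw [estimate_eq, Finset.sum_add_distrib, smul_add]

end Setup

lemma indepFun_average_collect {Ω α : Type*} [MeasurableSpace Ω] [MeasurableSpace α]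
    {μ : Measure Ω} {K m d : ℕ} [NeZero d] {Z : Fin K → Fin (m ⌈/⌉ d) → Ω → Vec d} {T : Ω → α}
    (h : IndepFun (fun ω k j => Z k j ω) T μ) (c : ℝ) :
    IndepFun (fun ω => c • ∑ k, collect fun j => Z k j ω) T μ := by
  have hφ : Measurable fun z : Fin K → Fin (m ⌈/⌉ d) → Vec d => c • ∑ k, collect (z k) :=
    (Finset.measurable_sum _ fun k _ => measurable_collect.comp
      (measurable_pi_apply k)).const_smul c
  exact h.comp hφ measurable_id

/-- The errors are independent of all training randomness `(W, J)`, hence of `X`, which is a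
measurable function of it. -/
theorem gaussian_errors {𝒰 Ω : Type*} [MeasurableSpace Ω] {μ : Measure Ω} [IsProbabilityMeasure μ]
    {K m d τ : ℕ} [NeZero K] [NeZero d] {S : Setup 𝒰 m d τ} {N : Fin K → ℕ}
    {W : Ω → Vec m} {J : ∀ k, Fin τ → Ω → Fin (N k)} {U : Fin K → Fin (m ⌈/⌉ d) → Ω → ℝ}
    {V : Fin K → Fin (m ⌈/⌉ d) → ℕ → Ω → Vec d} (hR : IsRoundRandomness μ N S.P W J U V)
    (D : ∀ k, Fin (N k) → 𝒰) (X : Ω → Fin K → Vec m)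
    (hX : X = fun ω => S.updates D (W ω) fun k t => J k t ω)
    (Z : Fin K → Fin (m ⌈/⌉ d) → Ω → Vec d)
    (hZ : Z = fun k j ω => S.subError (X ω k) (fun j => U k j ω) (fun j i => V k j i ω) j) :
    (∀ k j, ∀ᵐ u ∂(chiSquared (d + 2)),
      condDistrib (Z k j) (U k j) μ u = volume[|Metric.closedBall 0 (S.σ * √u)]) ∧
    (∀ k j, HasLaw (Z k j) (multivariateGaussian 0 (S.σ ^ 2 • 1)) μ) ∧
    iIndepFun (fun (p : Fin K × Fin (m ⌈/⌉ d)) => Z p.1 p.2) μ ∧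
    IndepFun (fun ω k j => Z k j ω) X μ ∧
    HasLaw (fun ω => (1 / (K : ℝ)) • ∑ k, collect fun j => Z k j ω)
      (multivariateGaussian 0 ((S.σ ^ 2 / K) • 1)) μ ∧
    IndepFun (fun ω => (1 / (K : ℝ)) • ∑ k, collect fun j => Z k j ω) X μ := by
  have hT : Measurable fun ω => (W ω, fun k t => J k t ω) :=
    hR.W_measurable.prodMk hR.measurable_indices
  obtain ⟨h1, h2, h3, h4⟩ := hR.errors_independent hT hR.train_shared_indep
    (x := fun q k => S.updates D q.1 q.2 k) (fun k => S.measurable_updates D k) (Z := Z)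
    (by rw [hZ, hX])
  have hlaw : ∀ k j, HasLaw (Z k j) (multivariateGaussian 0 (S.σ ^ 2 • 1)) μ := fun k j => by
    rw [← snd_chiSquared_compProd S.σ_pos]
    exact HasLaw.fun_comp (Y := Prod.snd) ⟨measurable_snd.aemeasurable, rfl⟩ (h2 k j)
  have hXu : Measurable fun (q : Vec m × (∀ k, Fin τ → Fin (N k))) => S.updates D q.1 q.2 :=
    measurable_pi_lambda _ fun k => S.measurable_updates D k
  have hZX : IndepFun (fun ω k j => Z k j ω) X μ := by
    rw [hX]
    exact h4.comp measurable_id hXu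
  refine ⟨fun k j => ?_, hlaw, h3, hZX,
    hasLaw_average_collect h1 (fun k j => (hlaw k j).map_eq) h3, indepFun_average_collect hZX _⟩
  have hU := (hR.U_law k j).map_eq
  have := condDistrib_ae_eq_of_measure_eq_compProd (μ := μ) (U k j) (h1 k j).aemeasurable
    (κ := uniformBallKernel d S.σ S.σ_pos.le) (by rw [hU]; exact (h2 k j).map_eq)
  rw [hU] at this
  exact this

/-! ### The privacy profile of the Gaussian mechanism -/

/-- The privacy profile of the Gaussian mechanism, for the ratio `x` of the sensitivity to the
standard deviation. -/
def gaussianProfile (x ε : ℝ) : ℝ :=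
  Phi (x / 2 - ε / x) - Real.exp ε * Phi (-(x / 2) - ε / x)

section Profile

variable {m : ℕ}

lemma gaussianReal_real_Ici (c r : ℝ) : (gaussianReal c 1).real (Set.Ici r) = Phi (c - r) := by
  have h : (gaussianReal 0 1).map (fun x => c - x) = gaussianReal c 1 := by
    rw [gaussianReal_map_const_sub, sub_zero]
  rw [Phi, cdf_eq_real, ← h, map_measureReal_apply (by fun_prop) measurableSet_Ici]
  congr 1
  ext x
  simp only [Set.mem_preimage, Set.mem_Ici, Set.mem_Iic]
  constructor <;> intro _ <;> linarith

lemma Phi_nonneg (x : ℝ) : 0 ≤ Phi x := cdf_nonneg _ x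

/-- The law of a normalized linear functional under an isotropic Gaussian measure. -/
lemma map_inner_isotropicGaussian (a b v : Vec m) {s : ℝ} (hs : 0 < s) (hv : v ≠ 0) :
    (multivariateGaussian a (s ^ 2 • 1)).map (fun z => inner ℝ (z - b) v / (s * ‖v‖)) =
      gaussianReal (inner ℝ (a - b) v / (s * ‖v‖)) 1 := by
  have hm : Measurable fun z : Vec m => inner ℝ (z - b) v / (s * ‖v‖) := by fun_prop
  have := Measure.isProbabilityMeasure_map (μ := multivariateGaussian a (s ^ 2 • 1))
    hm.aemeasurable
  have hv' : ‖v‖ ≠ 0 := norm_ne_zero_iff.2 hv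
  refine Measure.ext_of_charFun (funext fun t => ?_)
  rw [charFun_gaussianReal, charFun_apply_real, integral_map hm.aemeasurable (by fun_prop)]
  have h1 : ∀ z : Vec m, Complex.exp (t * ((inner ℝ (z - b) v / (s * ‖v‖) : ℝ) : ℂ) * Complex.I) =
      Complex.exp ((inner ℝ z ((t / (s * ‖v‖)) • v) : ℝ) * Complex.I) *
        Complex.exp (-(t * (inner ℝ b v / (s * ‖v‖) : ℝ)) * Complex.I) := by
    intro z
    rw [← Complex.exp_add, inner_sub_left, real_inner_smul_right]
    congr 1
    push_cast
    ring
  simp_rw [h1]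
  rw [integral_mul_const, ← charFun_apply, charFun_isotropicGaussian _ (sq_nonneg s),
    ← Complex.exp_add, norm_smul, inner_sub_left, real_inner_comm, real_inner_smul_right,
    Real.norm_eq_abs]
  have h2 : s ^ 2 * (|t / (s * ‖v‖)| * ‖v‖) ^ 2 = t ^ 2 := by
    rw [mul_pow, sq_abs]; field_simp
  have h3 : ((s ^ 2 : ℝ) : ℂ) * ((|t / (s * ‖v‖)| * ‖v‖ : ℝ) : ℂ) ^ 2 = (t : ℂ) ^ 2 := by
    rw [← Complex.ofReal_pow, ← Complex.ofReal_mul, h2, Complex.ofReal_pow]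
  rw [h3]
  congr 1
  push_cast
  ring

lemma isotropicGaussian_halfspace (a b v : Vec m) {s : ℝ} (hs : 0 < s) (hv : v ≠ 0) (r : ℝ) :
    (multivariateGaussian a (s ^ 2 • 1)).real {z | r ≤ inner ℝ (z - b) v / (s * ‖v‖)} =
      Phi (inner ℝ (a - b) v / (s * ‖v‖) - r) := by
  rw [← gaussianReal_real_Ici, ← map_inner_isotropicGaussian a b v hs hv,
    map_measureReal_apply (by fun_prop) measurableSet_Ici]
  rfl

/-- The density of an isotropic Gaussian measure. -/
def isotropicDensity (a : Vec m) (s : ℝ) (z : Vec m) : ℝ :=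
  (gaussianWeight m s Set.univ)⁻¹.toReal * Real.exp (-‖z - a‖ ^ 2 / (2 * s ^ 2))

lemma integrable_isotropicDensity (a : Vec m) {s : ℝ} (hs : 0 < s) :
    Integrable (isotropicDensity a s) :=
  ((integrable_gaussian m hs).comp_sub_right a).const_mul _

lemma isotropicGaussian_real_apply (a : Vec m) {s : ℝ} (hs : 0 < s) {T : Set (Vec m)}
    (hT : MeasurableSet T) :
    (multivariateGaussian a (s ^ 2 • 1)).real T = ∫ z in T, isotropicDensity a s z := by
  have h0 : ∀ T : Set (Vec m), MeasurableSet T →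
      (multivariateGaussian (0 : Vec m) (s ^ 2 • 1)).real T =
        ∫ z in T, (gaussianWeight m s Set.univ)⁻¹.toReal * Real.exp (-‖z‖ ^ 2 / (2 * s ^ 2)) := by
    intro T hT
    rw [isotropicGaussian_eq_smul m hs, measureReal_ennreal_smul_apply, integral_const_mul,
      measureReal_def, gaussianWeight, withDensity_apply _ hT, integral_eq_lintegral_of_nonneg_ae
        (ae_of_all _ fun z => (Real.exp_pos _).le) (by fun_prop)]
  have h1 := map_add_isotropicGaussian a 0 (sq_nonneg s)
  rw [add_zero] at h1
  have h2 := (measurePreserving_add_left volume a).setIntegral_preimage_emb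
    (measurableEmbedding_addLeft a) (isotropicDensity a s) T
  simp only [isotropicDensity, add_sub_cancel_left] at h2
  rw [← h1, map_measureReal_apply (by fun_prop) hT, h0 _ (hT.preimage (by fun_prop)), h2]
  rfl

/-- Neyman–Pearson bound for two isotropic Gaussian measures. -/
lemma isotropicGaussian_le_of_ne {a b : Vec m} {s : ℝ} (hs : 0 < s) (hab : a ≠ b) (ε : ℝ)
    {T : Set (Vec m)} (hT : MeasurableSet T) :
    (multivariateGaussian a (s ^ 2 • 1)).real T ≤
      Real.exp ε * (multivariateGaussian b (s ^ 2 • 1)).real T +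
        gaussianProfile (‖a - b‖ / s) ε := by
  set v := a - b with hv_def
  have hv : v ≠ 0 := sub_ne_zero.2 hab
  have hn : 0 < ‖v‖ := norm_pos_iff.2 hv
  have hk : 0 < (gaussianWeight m s Set.univ)⁻¹.toReal := by
    refine ENNReal.toReal_pos (ENNReal.inv_ne_zero.2 ?_)
      (ENNReal.inv_ne_top.2 (gaussianWeight_univ_ne_zero m hs))
    rw [gaussianWeight_univ m hs]; exact ENNReal.ofReal_ne_top
  let f : Vec m → ℝ := fun z => isotropicDensity a s z - Real.exp ε * isotropicDensity b s z
  have hfi : Integrable f :=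
    (integrable_isotropicDensity a hs).sub ((integrable_isotropicDensity b hs).const_mul _)
  have hfm : StronglyMeasurable f := by
    refine Continuous.stronglyMeasurable ?_
    unfold f isotropicDensity
    fun_prop
  -- The log-likelihood ratio is affine in `z`, so the optimal test is a half-space; with `x = ‖v‖ /
  -- s` its normalized threshold is `x / 2 + ε / x`.
  have hset : {z | 0 ≤ f z} =
      {z | ‖v‖ / s / 2 + ε / (‖v‖ / s) ≤ inner ℝ (z - b) v / (s * ‖v‖)} := by
    ext z
    have hz : z - a = (z - b) - v := by rw [hv_def]; abel
    have hsq : ‖z - a‖ ^ 2 = ‖z - b‖ ^ 2 - 2 * inner ℝ (z - b) v + ‖v‖ ^ 2 := by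
      rw [hz, norm_sub_sq_real]
    have e1 : ε + -‖z - b‖ ^ 2 / (2 * s ^ 2) ≤ -‖z - a‖ ^ 2 / (2 * s ^ 2) ↔
        2 * s ^ 2 * ε + ‖v‖ ^ 2 ≤ 2 * inner ℝ (z - b) v := by
      rw [hsq, ← sub_nonneg, ← sub_nonneg (b := 2 * s ^ 2 * ε + ‖v‖ ^ 2)]
      have : -(‖z - b‖ ^ 2 - 2 * inner ℝ (z - b) v + ‖v‖ ^ 2) / (2 * s ^ 2) -
          (ε + -‖z - b‖ ^ 2 / (2 * s ^ 2)) =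
          (2 * inner ℝ (z - b) v - (2 * s ^ 2 * ε + ‖v‖ ^ 2)) / (2 * s ^ 2) := by
        field_simp
        ring
      rw [this]
      rw [le_div_iff₀ (by positivity), zero_mul]
    simp only [Set.mem_ofPred_eq, f, isotropicDensity]
    rw [sub_nonneg, mul_left_comm, mul_le_mul_iff_right₀ hk, ← Real.exp_add, Real.exp_le_exp, e1,
      le_div_iff₀ (by positivity)]
    have : (‖v‖ / s / 2 + ε / (‖v‖ / s)) * (s * ‖v‖) = (2 * s ^ 2 * ε + ‖v‖ ^ 2) / 2 := by
      field_simp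
      ring
    rw [this, div_le_iff₀ two_pos, mul_comm _ (2 : ℝ)]
  have hint : ∀ {A : Set (Vec m)}, MeasurableSet A → ∫ z in A, f z =
      (multivariateGaussian a (s ^ 2 • 1)).real A -
        Real.exp ε * (multivariateGaussian b (s ^ 2 • 1)).real A := by
    intro A hA
    rw [isotropicGaussian_real_apply a hs hA, isotropicGaussian_real_apply b hs hA,
      ← integral_const_mul, integral_sub (integrable_isotropicDensity a hs).integrableOn
        ((integrable_isotropicDensity b hs).const_mul _).integrableOn]
  have hH : MeasurableSet {z | 0 ≤ f z} := measurableSet_le measurable_const hfm.measurable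
  -- Neyman–Pearson: no set has a larger integral of `f` than the set where `f` is nonnegative.
  have hle := setIntegral_le_nonneg hT hfm hfi
  rw [hint hT, hint hH, hset, isotropicGaussian_halfspace a b v hs hv,
    isotropicGaussian_halfspace b b v hs hv, sub_self, inner_zero_left, ← hv_def,
    real_inner_self_eq_norm_sq] at hle
  have e1 : ‖v‖ ^ 2 / (s * ‖v‖) - (‖v‖ / s / 2 + ε / (‖v‖ / s)) =
      ‖v‖ / s / 2 - ε / (‖v‖ / s) := by
    field_simp
    ring
  have e2 : 0 / (s * ‖v‖) - (‖v‖ / s / 2 + ε / (‖v‖ / s)) =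
      -(‖v‖ / s / 2) - ε / (‖v‖ / s) := by
    ring
  rw [e1, e2] at hle
  rw [gaussianProfile]
  linarith

/-- The profile is the optimal value over all thresholds. -/
lemma Phi_le_gaussianProfile {x : ℝ} (hx : 0 < x) (t ε : ℝ) :
    Phi (x - t) ≤ Real.exp ε * Phi (-t) + gaussianProfile x ε := by
  -- Each threshold `t` is a half-line test between one-dimensional Gaussians with means `x` and
  -- `0`.
  let a : Vec 1 := EuclideanSpace.single 0 x
  have hna : ‖a‖ = x := by simp [a, abs_of_pos hx]
  have ha : a ≠ 0 := norm_ne_zero_iff.1 (hna ▸ hx.ne')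
  have hT : MeasurableSet {z : Vec 1 | t ≤ inner ℝ (z - 0) a / (1 * ‖a‖)} :=
    measurableSet_le measurable_const (by fun_prop)
  have h := isotropicGaussian_le_of_ne one_pos ha ε hT
  rw [isotropicGaussian_halfspace a 0 a one_pos ha, isotropicGaussian_halfspace 0 0 a one_pos ha,
    sub_zero, sub_zero, inner_zero_left, real_inner_self_eq_norm_sq, hna] at h
  convert h using 2
  · congr 1; field_simp
  · simp
  · simp

/-- The Neyman–Pearson bound for the empty test. -/
lemma gaussianProfile_nonneg {x : ℝ} (hx : 0 < x) (ε : ℝ) : 0 ≤ gaussianProfile x ε := by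
  let a : Vec 1 := EuclideanSpace.single 0 x
  have hna : ‖a‖ = x := by simp [a, abs_of_pos hx]
  have ha : a ≠ 0 := norm_ne_zero_iff.1 (hna ▸ hx.ne')
  have h := isotropicGaussian_le_of_ne one_pos ha ε MeasurableSet.empty
  simpa [hna] using h

/-- The threshold optimal for `x` is admissible for `y`: the subtracted term is unchanged and the
first one increases. -/
lemma gaussianProfile_mono {x y : ℝ} (hx : 0 < x) (hxy : x ≤ y) (ε : ℝ) :
    gaussianProfile x ε ≤ gaussianProfile y ε := by
  have h := Phi_le_gaussianProfile (hx.trans_le hxy) (x / 2 + ε / x) ε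
  have h2 : Phi (x / 2 - ε / x) ≤ Phi (y - (x / 2 + ε / x)) :=
    monotone_cdf _ (by linarith)
  rw [neg_add'] at h
  rw [gaussianProfile]
  linarith

/-- The threshold optimal for `ε'`, used at the smaller `ε`, subtracts less. -/
lemma gaussianProfile_anti {x : ℝ} (hx : 0 < x) {ε ε' : ℝ} (h : ε ≤ ε') :
    gaussianProfile x ε' ≤ gaussianProfile x ε := by
  have h1 := Phi_le_gaussianProfile hx (x / 2 + ε' / x) ε
  have h2 : Real.exp ε * Phi (-(x / 2) - ε' / x) ≤ Real.exp ε' * Phi (-(x / 2) - ε' / x) :=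
    mul_le_mul_of_nonneg_right (Real.exp_le_exp.2 h) (Phi_nonneg _)
  rw [neg_add', show x - (x / 2 + ε' / x) = x / 2 - ε' / x by ring] at h1
  rw [gaussianProfile]
  linarith

/-- The Gaussian mechanism with sensitivity `Δ`. -/
lemma isotropicGaussian_le {a b : Vec m} {s Δ ε : ℝ} (hs : 0 < s) (hΔ : 0 < Δ) (hε : 0 ≤ ε)
    (hab : ‖a - b‖ ≤ Δ) {T : Set (Vec m)} (hT : MeasurableSet T) :
    (multivariateGaussian a (s ^ 2 • 1)).real T ≤
      Real.exp ε * (multivariateGaussian b (s ^ 2 • 1)).real T + gaussianProfile (Δ / s) ε := by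
  rcases eq_or_ne a b with rfl | hne
  · have h1 : (multivariateGaussian a (s ^ 2 • 1)).real T ≤
        Real.exp ε * (multivariateGaussian a (s ^ 2 • 1)).real T :=
      le_mul_of_one_le_left measureReal_nonneg (Real.one_le_exp hε)
    linarith [gaussianProfile_nonneg (div_pos hΔ hs) ε]
  · refine (isotropicGaussian_le_of_ne hs hne ε hT).trans ?_
    gcongr
    exact gaussianProfile_mono (div_pos (norm_pos_iff.2 (sub_ne_zero.2 hne)) hs) (by gcongr) ε

end Profile

/-! ### Amplification by subsampling -/

lemma sum_Icc_binomial {q : ℝ} (τ : ℕ) :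
    ∑ j ∈ Finset.Icc 1 τ, (τ.choose j : ℝ) * q ^ j * (1 - q) ^ (τ - j) = 1 - (1 - q) ^ τ := by
  have h := add_pow q (1 - q) τ
  rw [add_sub_cancel, one_pow, Finset.range_eq_Ico, Finset.sum_eq_sum_Ico_succ_bot (by omega)] at h
  simp only [pow_zero, tsub_zero, Nat.choose_zero_right, Nat.cast_one, mul_one, one_mul,
    zero_add] at h
  rw [eq_sub_iff_add_eq', ← Finset.Ico_add_one_right_eq_Icc]
  refine Eq.trans ?_ h.symm
  congr 1
  exact Finset.sum_congr rfl fun j _ => by ring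

/-- Write `p` as the binomial probability of at least one hit and compare term by term: passing from
`ε` to `ε / j` raises the profile, and the quotient of exponentials is at least one. -/
lemma mul_gaussianProfile_le_privacyDelta {K n τ : ℕ} [NeZero K] [NeZero τ] (hn : 0 < n)
    {γ σ ε : ℝ} (hγ : 0 < γ) (hσ : 0 < σ) (hε : 0 < ε) :
    (1 - (1 - 1 / (n : ℝ)) ^ τ) * gaussianProfile (2 * τ * γ / (√K * σ)) ε ≤
      privacyDelta K n τ γ σ ε := by
  have hK : 0 < √(K : ℝ) := Real.sqrt_pos.2 (Nat.cast_pos.2 (NeZero.pos K))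
  have hτ : 0 < (τ : ℝ) := Nat.cast_pos.2 (NeZero.pos τ)
  have hx : 0 < 2 * τ * γ / (√K * σ) := by positivity
  have hq : 1 / (n : ℝ) ≤ 1 := by
    rw [div_le_one (by positivity)]; exact_mod_cast hn
  rw [← sum_Icc_binomial, Finset.sum_mul, privacyDelta]
  refine Finset.sum_le_sum fun j hj => ?_
  have hj1 : 1 ≤ j := (Finset.mem_Icc.1 hj).1
  have hj' : (1 : ℝ) ≤ j := by exact_mod_cast hj1
  have hjpos : (0 : ℝ) < j := by linarith
  have hle : ε / j ≤ ε := div_le_self hε.le hj'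
  have hone : 1 ≤ (Real.exp ε - 1) / (Real.exp (ε / j) - 1) := by
    have hpos : 0 < Real.exp (ε / j) - 1 := sub_pos.2 (Real.one_lt_exp_iff.2 (by positivity))
    rw [le_div_iff₀ hpos, one_mul]
    exact sub_le_sub_right (Real.exp_le_exp.2 hle) 1
  have hprof : Phi (τ * γ / (√K * σ) - √K * ε * σ / (2 * j * τ * γ)) -
      Real.exp (ε / j) * Phi (-(τ * γ / (√K * σ)) - √K * ε * σ / (2 * j * τ * γ)) =
        gaussianProfile (2 * τ * γ / (√K * σ)) (ε / j) := by
    have e1 : 2 * τ * γ / (√K * σ) / 2 = τ * γ / (√K * σ) := by field_simp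
    have e2 : ε / j / (2 * τ * γ / (√K * σ)) = √K * ε * σ / (2 * j * τ * γ) := by field_simp
    rw [gaussianProfile, e1, e2]
  rw [hprof, mul_assoc _ (_ / _)]
  have hw : 0 ≤ (τ.choose j : ℝ) * (1 / (n : ℝ)) ^ j * (1 - 1 / (n : ℝ)) ^ (τ - j) :=
    mul_nonneg (by positivity) (pow_nonneg (sub_nonneg.2 hq) _)
  refine mul_le_mul_of_nonneg_left ?_ hw
  calc gaussianProfile (2 * τ * γ / (√K * σ)) ε
      ≤ gaussianProfile (2 * τ * γ / (√K * σ)) (ε / j) := gaussianProfile_anti hx hle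
    _ ≤ _ := le_mul_of_one_le_left (gaussianProfile_nonneg hx _) hone

/-- Amplification: `s` is the uniform sample, `H` the event that it meets the changed entry. -/
lemma amplification {ι : Type*} [Fintype ι] [DecidableEq ι] [Nonempty ι] (H : Finset ι)
    (a b : ι → ℝ) {E g : ℝ} (hE : 1 ≤ E) (hcross : ∀ s s', a s ≤ E * a s' + g)
    (hH : ∀ s ∈ H, a s ≤ E * b s + g) (hHc : ∀ s ∉ H, a s = b s) :
    ∑ s, a s ≤ (1 + H.card / Fintype.card ι * (E - 1)) * ∑ s, b s + H.card * g := by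
  set n : ℝ := (Fintype.card ι : ℝ)
  set k : ℝ := (H.card : ℝ)
  have hn : 0 < n := Nat.cast_pos.2 Fintype.card_pos
  have hk : 0 ≤ k := Nat.cast_nonneg _
  have hc : ((Hᶜ.card : ℕ) : ℝ) = n - k := by
    rw [Finset.card_compl, Nat.cast_sub (Finset.card_le_univ H)]
  have hbc : ∑ s ∈ Hᶜ, b s = ∑ s ∈ Hᶜ, a s :=
    Finset.sum_congr rfl fun s hs => (hHc s (Finset.mem_compl.1 hs)).symm
  rw [← Finset.sum_add_sum_compl H a, ← Finset.sum_add_sum_compl H b, hbc]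
  set A := ∑ s ∈ H, a s with hA
  set B := ∑ s ∈ H, b s with hB
  set Q := ∑ s ∈ Hᶜ, a s with hQ
  have h1 : A ≤ E * B + k * g := by
    calc A ≤ ∑ s ∈ H, (E * b s + g) := Finset.sum_le_sum hH
      _ = _ := by rw [Finset.sum_add_distrib, ← Finset.mul_sum, Finset.sum_const, nsmul_eq_mul]
  -- Sum `hcross` over all pairs in `H × Hᶜ`; without dividing by `n - k`, the case `H = univ` is
  -- included.
  have h2 : (n - k) * A ≤ E * k * Q + k * (n - k) * g := by
    calc (n - k) * A = ∑ s ∈ H, ∑ _s' ∈ Hᶜ, a s := by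
          simp_rw [Finset.sum_const, nsmul_eq_mul, hc]
          rw [← Finset.mul_sum]
      _ ≤ ∑ _s ∈ H, ∑ s' ∈ Hᶜ, (E * a s' + g) :=
          Finset.sum_le_sum fun s _ => Finset.sum_le_sum fun s' _ => hcross s s'
      _ = _ := by
          simp_rw [Finset.sum_add_distrib, ← Finset.mul_sum, Finset.sum_const, nsmul_eq_mul, hc]
          ring
  have hE0 : 0 < E := by linarith
  -- The weights `n + k (E - 1)` for `h1` and `E - 1` for `h2` make the coefficients of `A` add up
  -- to `n E`.
  have h3 := mul_le_mul_of_nonneg_left h1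
    (add_nonneg hn.le (mul_nonneg hk (sub_nonneg.2 hE)))
  have h4 := mul_le_mul_of_nonneg_left h2 (sub_nonneg.2 hE)
  have h5 : (n * E) * (A + Q) ≤ (n * E) * ((1 + k / n * (E - 1)) * (B + Q) + k * g) := by
    have : (n * E) * ((1 + k / n * (E - 1)) * (B + Q) + k * g) =
        E * (n + k * (E - 1)) * (B + Q) + n * E * k * g := by
      field_simp
    rw [this]
    linarith
  exact le_of_mul_le_mul_left h5 (mul_pos hn hE0)

/-- Count the complement: samples avoiding `i` take values in the `n - 1` other indices. -/
lemma card_meets {n τ : ℕ} (hn : 0 < n) (i : Fin n) :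
    (((Finset.univ : Finset (Fin τ → Fin n)).filter fun s => ∃ t, s t = i).card : ℝ) /
      Fintype.card (Fin τ → Fin n) = 1 - (1 - 1 / (n : ℝ)) ^ τ := by
  have h1 : ((Finset.univ : Finset (Fin τ → Fin n)).filter fun s => ∃ t, s t = i) =
      (Fintype.piFinset fun _ => {i}ᶜ)ᶜ := by
    ext s
    simp
  have hn' : (0 : ℝ) < n := Nat.cast_pos.2 hn
  have h2 : (Fintype.piFinset fun _ : Fin τ => ({i}ᶜ : Finset (Fin n))).card = (n - 1) ^ τ := by
    simp [Fintype.card_piFinset, Finset.card_compl]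
  rw [h1, Finset.card_compl, Nat.cast_sub (Finset.card_le_univ _), h2, Fintype.card_fun,
    Fintype.card_fin, Fintype.card_fin, Nat.cast_pow, Nat.cast_pow, Nat.cast_sub hn, Nat.cast_one,
    sub_div, div_self (by positivity), ← div_pow, sub_div, div_self hn'.ne']

/-! ### Privacy of one round -/

lemma norm_average_sub_le {K m : ℕ} [NeZero K] {γ : ℝ} {x y : Fin K → Vec m} {k : Fin K}
    (hx : ‖x k‖ ≤ γ) (hy : ‖y k‖ ≤ γ) (h : ∀ l, l ≠ k → x l = y l) :
    ‖(1 / (K : ℝ)) • ∑ l, x l - (1 / (K : ℝ)) • ∑ l, y l‖ ≤ 2 * γ / K := by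
  have hK : (0 : ℝ) < K := Nat.cast_pos.2 (NeZero.pos K)
  rw [← smul_sub, ← Finset.sum_sub_distrib, Finset.sum_eq_single k
    (fun l _ hl => by rw [h l hl, sub_self]) (by simp), norm_smul, Real.norm_eq_abs,
    abs_of_nonneg (by positivity)]
  calc 1 / (K : ℝ) * ‖x k - y k‖ ≤ 1 / (K : ℝ) * (γ + γ) := by
        gcongr
        exact (norm_sub_le _ _).trans (add_le_add hx hy)
    _ = _ := by ring

namespace IsRoundRandomness

variable {𝒰 Ω : Type*} [MeasurableSpace Ω] {μ : Measure Ω} [IsProbabilityMeasure μ]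
  {K m d τ : ℕ} {P : Set (Vec d)} {N : Fin K → ℕ} {W : Ω → Vec m}
  {J : ∀ k, Fin τ → Ω → Fin (N k)} {U : Fin K → Fin (m ⌈/⌉ d) → Ω → ℝ}
  {V : Fin K → Fin (m ⌈/⌉ d) → ℕ → Ω → Vec d}

/-- All values of the sample indices have the same probability. -/
lemma map_indices_singleton (hR : IsRoundRandomness μ N P W J U V)
    (j : ∀ k, Fin τ → Fin (N k)) :
    (μ.map fun ω k t => J k t ω).real {j} =
      (Fintype.card (∀ k, Fin τ → Fin (N k)) : ℝ)⁻¹ := by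
  have hJ : Measurable fun ω k t => J k t ω :=
    measurable_pi_lambda _ fun k => measurable_pi_lambda _ fun t => hR.J_measurable k t
  have := Measure.isProbabilityMeasure_map (μ := μ) hJ.aemeasurable
  have hc : ∀ j : ∀ k, Fin τ → Fin (N k), (μ.map fun ω k t => J k t ω).real {j} =
      (∏ p : Fin K × Fin τ, (uniformOn (Set.univ : Set (Fin (N p.1)))) {j p.1 p.2}).toReal := by
    intro j
    rw [map_measureReal_apply hJ (measurableSet_singleton j), measureReal_def]
    congr 1
    have h := hR.J_indep.measure_inter_preimage_eq_mul Finset.univ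
      (sets := fun p => {j p.1 p.2}) fun p _ => measurableSet_singleton _
    have hset : (fun ω k t => J k t ω) ⁻¹' {j} =
        ⋂ p ∈ (Finset.univ : Finset (Fin K × Fin τ)), J p.1 p.2 ⁻¹' {j p.1 p.2} := by
      ext ω
      simp [funext_iff]
    rw [hset, h]
    refine Finset.prod_congr rfl fun p _ => ?_
    rw [← (hR.J_law p.1 p.2).map_eq, Measure.map_apply (hR.J_measurable p.1 p.2)
      (measurableSet_singleton _)]
  have hconst : ∀ j' : ∀ k, Fin τ → Fin (N k), (μ.map fun ω k t => J k t ω).real {j'} =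
      (μ.map fun ω k t => J k t ω).real {j} := fun j' => by
    rw [hc, hc]
    congr 1
    refine Finset.prod_congr rfl fun p _ => ?_
    rw [uniformOn_univ, uniformOn_univ, Measure.count_singleton, Measure.count_singleton]
  -- All singletons have equal mass, so total mass one determines it.
  have hsum : ∑ j', (μ.map fun ω k t => J k t ω).real {j'} = 1 := by
    rw [sum_measureReal_singleton, Finset.coe_univ, probReal_univ]
  simp_rw [hconst, Finset.sum_const, Finset.card_univ, nsmul_eq_mul] at hsum
  exact eq_inv_of_mul_eq_one_right hsum

end IsRoundRandomness

section Output

variable {𝒰 Ω : Type*} [MeasurableSpace Ω] {μ : Measure Ω} [IsProbabilityMeasure μ]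
  {K m d τ : ℕ} [NeZero K] [NeZero d] {S : Setup 𝒰 m d τ} {N : Fin K → ℕ} {W : Ω → Vec m}
  {J : ∀ k, Fin τ → Ω → Fin (N k)} {U : Fin K → Fin (m ⌈/⌉ d) → Ω → ℝ}
  {V : Fin K → Fin (m ⌈/⌉ d) → ℕ → Ω → Vec d}

/-- For a fixed global model, the output of the round is a uniform mixture of Gaussian laws. -/
lemma output_real_eq (hR : IsRoundRandomness μ N S.P W J U V) (w : Vec m)
    (D : ∀ k, Fin (N k) → 𝒰) {T : Set (Vec m)} (hT : MeasurableSet T) :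
    μ.real {ω | (1 / (K : ℝ)) • ∑ k, S.estimate (S.updates D w (fun k t => J k t ω) k)
        (fun j => U k j ω) (fun j i => V k j i ω) ∈ T} =
      (Fintype.card (∀ k, Fin τ → Fin (N k)) : ℝ)⁻¹ * ∑ j : ∀ k, Fin τ → Fin (N k),
        (multivariateGaussian ((1 / (K : ℝ)) • ∑ k, S.updates D w j k)
          ((S.σ / √K) ^ 2 • 1)).real T := by
  have hJ := hR.measurable_indices
  have := Measure.isProbabilityMeasure_map (μ := μ) hJ.aemeasurable
  let Z : Fin K → Fin (m ⌈/⌉ d) → Ω → Vec d := fun k j ω =>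
    S.subError (S.updates D w (fun k t => J k t ω) k) (fun j => U k j ω)
      (fun j i => V k j i ω) j
  -- With the global model fixed at `w`, only the sample indices remain as training randomness.
  obtain ⟨h1, h2, h3, h4⟩ := hR.errors_independent (T := fun ω k t => J k t ω) hJ
    (hR.train_shared_indep.comp measurable_snd measurable_id)
    (x := fun q k => S.updates D w q k) (fun k => measurable_of_countable _) (Z := Z) rfl
  have hlaw : ∀ k j, μ.map (Z k j) = multivariateGaussian 0 (S.σ ^ 2 • 1) := fun k j => by
    rw [← snd_chiSquared_compProd S.σ_pos, ← (h2 k j).map_eq, Measure.snd,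
      Measure.map_map measurable_snd ((hR.U_measurable k j).prodMk (h1 k j))]
    rfl
  have hζ := hasLaw_average_collect h1 hlaw h3
  have hind := (indepFun_average_collect h4 (1 / (K : ℝ))).symm
  have hjoint := (indepFun_iff_hasLaw_prodMk_prod ⟨hJ.aemeasurable, rfl⟩ hζ).1 hind
  have hσ : S.σ ^ 2 / K = (S.σ / √K) ^ 2 := by
    rw [div_pow, Real.sq_sqrt (Nat.cast_nonneg K)]
  rw [hσ] at hjoint
  let f : (∀ k, Fin τ → Fin (N k)) × Vec m → Vec m := fun q =>
    (1 / (K : ℝ)) • ∑ k, S.updates D w q.1 k + q.2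
  have hf : Measurable f := by
    have h : ∀ j, Measurable fun z => f (j, z) := fun j =>
      measurable_const_add ((1 / (K : ℝ)) • ∑ k, S.updates D w j k)
    exact measurable_from_prod_countable_right h
  have hset : {ω | (1 / (K : ℝ)) • ∑ k, S.estimate (S.updates D w (fun k t => J k t ω) k)
      (fun j => U k j ω) (fun j i => V k j i ω) ∈ T} =
        {ω | f ((fun k t => J k t ω), (1 / (K : ℝ)) • ∑ k, collect fun j => Z k j ω) ∈ T} := by
    ext ω
    simp only [Set.mem_ofPred_eq, f]
    rw [S.average_estimate_eq]
  rw [hset, hjoint.measureReal_eq (p := fun q => f q ∈ T) (hf hT), measureReal_def,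
    show {q | f q ∈ T} = f ⁻¹' T from rfl, Measure.prod_apply (hf hT), lintegral_fintype, ENNReal.toReal_sum fun j _ =>
      ENNReal.mul_ne_top (measure_ne_top _ _) (measure_ne_top _ _), Finset.mul_sum]
  refine Finset.sum_congr rfl fun j _ => ?_
  rw [ENNReal.toReal_mul, ← measureReal_def _ {j}, hR.map_indices_singleton, mul_comm]
  congr 1
  have hadd := map_add_isotropicGaussian ((1 / (K : ℝ)) • ∑ k, S.updates D w j k) 0
    (sq_nonneg (S.σ / √K))
  rw [add_zero] at hadd
  rw [← hadd, map_measureReal_apply (measurable_const_add _) hT, measureReal_def]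
  rfl

theorem isDP_output [NeZero τ] (hN : ∀ k, 0 < N k) (hR : IsRoundRandomness μ N S.P W J U V)
    (w : Vec m) (k : Fin K) {ε : ℝ} (hε : 0 < ε) :
    IsDP (AdjClient k) μ
      (fun (D : ∀ k, Fin (N k) → 𝒰) ω => (1 / (K : ℝ)) • ∑ k',
        S.estimate (S.updates D w (fun k t => J k t ω) k') (fun j => U k' j ω)
          (fun j i => V k' j i ω))
      (privacyEps (N k) τ ε) (privacyDelta K (N k) τ S.γ S.σ ε) := by
  classical
  rintro D D' ⟨i, ξ, hD'⟩ T hT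
  simp only
  rw [output_real_eq hR w D hT, output_real_eq hR w D' hT]
  have hKpos : (0 : ℝ) < K := Nat.cast_pos.2 (NeZero.pos K)
  have hτpos : (1 : ℝ) ≤ τ := by exact_mod_cast NeZero.one_le
  have hs : 0 < S.σ / √K := div_pos S.σ_pos (Real.sqrt_pos.2 hKpos)
  -- The actual sensitivity is `2γ/K`; it is enlarged by `τ ≥ 1` to match the stated `δ`.
  have hΔ : 0 < 2 * τ * S.γ / K := by have := S.γ_pos; positivity
  have : Nonempty (Fin τ → Fin (N k)) := ⟨fun _ => ⟨0, hN k⟩⟩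
  set g : ℝ := gaussianProfile (2 * τ * S.γ / (√K * S.σ)) ε with hg
  have hratio : 2 * τ * S.γ / K / (S.σ / √K) = 2 * τ * S.γ / (√K * S.σ) := by
    have h := Real.mul_self_sqrt hKpos.le
    have h0 := (Real.sqrt_pos.2 hKpos).ne'
    have := S.σ_pos.ne'
    field_simp
    rw [Real.sq_sqrt hKpos.le]
  -- comparison of two runs that differ only in client `k`
  have hcmp : ∀ x y : Fin K → Vec m, ‖x k‖ ≤ S.γ → ‖y k‖ ≤ S.γ → (∀ l, l ≠ k → x l = y l) →
      (multivariateGaussian ((1 / (K : ℝ)) • ∑ l, x l) ((S.σ / √K) ^ 2 • 1)).real T ≤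
        Real.exp ε * (multivariateGaussian ((1 / (K : ℝ)) • ∑ l, y l)
          ((S.σ / √K) ^ 2 • 1)).real T + g := by
    intro x y hx hy hxy
    rw [hg, ← hratio]
    refine isotropicGaussian_le hs hΔ hε.le ((norm_average_sub_le hx hy hxy).trans ?_) hT
    have := S.γ_pos
    gcongr
    nlinarith
  have hnorm : ∀ (D : ∀ k, Fin (N k) → 𝒰) j l, ‖S.updates D w j l‖ ≤ S.γ := fun _ _ _ =>
    norm_clip_le S.γ_pos _
  -- Separate the indices of client `k` from those of the others, so that amplification applies with
  -- the latter frozen at `r`.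
  let e := Equiv.piSplitAt k fun l => Fin τ → Fin (N l)
  have he_self : ∀ s r, e.symm (s, r) k = s := fun s r => by
    simp [e, Equiv.piSplitAt]
  have he_ne : ∀ s s' r l, l ≠ k → e.symm (s, r) l = e.symm (s', r) l := fun s s' r l hl => by
    simp [e, Equiv.piSplitAt, hl]
  have hD_ne : ∀ j l, l ≠ k → S.updates D w j l = S.updates D' w j l := fun j l hl => by
    rw [Setup.updates, Setup.updates, hD', Function.update_of_ne hl]
  have hupd_ne : ∀ (D : ∀ k, Fin (N k) → 𝒰) s s' r l, l ≠ k →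
      S.updates D w (e.symm (s, r)) l = S.updates D w (e.symm (s', r)) l := fun D s s' r l hl => by
    rw [Setup.updates, Setup.updates, he_ne s s' r l hl]
  let a : (∀ k, Fin (N k) → 𝒰) → (∀ k, Fin τ → Fin (N k)) → ℝ := fun D j =>
    (multivariateGaussian ((1 / (K : ℝ)) • ∑ l, S.updates D w j l) ((S.σ / √K) ^ 2 • 1)).real T
  let H : Finset (Fin τ → Fin (N k)) := Finset.univ.filter fun s => ∃ t, s t = i
  set p : ℝ := 1 - (1 - 1 / (N k : ℝ)) ^ τ with hp
  have hcard : (H.card : ℝ) / Fintype.card (Fin τ → Fin (N k)) = p := card_meets (hN k) i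
  have hp0 : 0 ≤ p := by rw [← hcard]; positivity
  have hamp : ∀ r, ∑ s, a D (e.symm (s, r)) ≤
      (1 + p * (Real.exp ε - 1)) * ∑ s, a D' (e.symm (s, r)) + H.card * g := by
    intro r
    rw [← hcard]
    -- Samples in `H` are compared across databases and with other samples on `D`; outside `H` the
    -- changed entry is never read.
    refine amplification H (fun s => a D (e.symm (s, r))) (fun s => a D' (e.symm (s, r)))
      (Real.one_le_exp hε.le) (fun s s' => ?_) (fun s _ => ?_) fun s hs => ?_
    · exact hcmp _ _ (hnorm _ _ _) (hnorm _ _ _) (hupd_ne D s s' r)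
    · exact hcmp _ _ (hnorm _ _ _) (hnorm _ _ _) (hD_ne _)
    · have : S.updates D w (e.symm (s, r)) = S.updates D' w (e.symm (s, r)) := by
        ext1 l
        rcases eq_or_ne l k with rfl | hl
        · have hs' : ∀ t, s t ≠ i := by simpa [H] using hs
          rw [Setup.updates, Setup.updates, he_self, hD', Function.update_self]
          congr 1
          ext1 t
          rw [Function.update_of_ne (hs' t)]
        · exact hD_ne _ l hl
      simp only [a, this]
  have hsplit : ∀ D, ∑ j, a D j = ∑ r, ∑ s, a D (e.symm (s, r)) := fun D => by
    rw [← Fintype.sum_prod_type_right' (f := fun s r => a D (e.symm (s, r)))]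
    exact (Equiv.sum_comp e.symm (a D)).symm
  have hexp : Real.exp (privacyEps (N k) τ ε) = 1 + p * (Real.exp ε - 1) := by
    rw [privacyEps, Real.exp_log]
    have : 0 ≤ p * (Real.exp ε - 1) := mul_nonneg hp0 (sub_nonneg.2 (Real.one_le_exp hε.le))
    linarith
  have hδ : p * g ≤ privacyDelta K (N k) τ S.γ S.σ ε :=
    mul_gaussianProfile_le_privacyDelta (hN k) S.γ_pos S.σ_pos hε
  change _ * ∑ j, a D j ≤ _ * (_ * ∑ j, a D' j) + _
  have hc : (Fintype.card (∀ k, Fin τ → Fin (N k)) : ℝ) =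
      Fintype.card (Fin τ → Fin (N k)) *
        Fintype.card (∀ l : {l // l ≠ k}, Fin τ → Fin (N l)) := by
    rw [Fintype.card_congr e, Fintype.card_prod, Nat.cast_mul]
  have hR0 : (0 : ℝ) < Fintype.card (∀ l : {l // l ≠ k}, Fin τ → Fin (N l)) := by
    have : Nonempty (∀ l : {l // l ≠ k}, Fin τ → Fin (N l)) := ⟨fun l _ => ⟨0, hN l⟩⟩
    exact Nat.cast_pos.2 Fintype.card_pos
  have hS0 : (0 : ℝ) < Fintype.card (Fin τ → Fin (N k)) := Nat.cast_pos.2 Fintype.card_pos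
  have htot : ∑ j, a D j ≤ (1 + p * (Real.exp ε - 1)) * ∑ j, a D' j +
      Fintype.card (∀ k, Fin τ → Fin (N k)) * (p * g) := by
    rw [hsplit, hsplit, Finset.mul_sum]
    calc _ ≤ ∑ r, ((1 + p * (Real.exp ε - 1)) * ∑ s, a D' (e.symm (s, r)) + H.card * g) :=
          Finset.sum_le_sum fun r _ => hamp r
      _ = _ := by
          rw [Finset.sum_add_distrib, Finset.sum_const, Finset.card_univ, nsmul_eq_mul, hc,
            ← hcard]
          field_simp
  have hcpos : (0 : ℝ) < Fintype.card (∀ k, Fin τ → Fin (N k)) := hc ▸ mul_pos hS0 hR0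
  rw [hexp, inv_mul_le_iff₀ hcpos, mul_add, mul_left_comm, mul_inv_cancel_left₀ hcpos.ne']
  exact htot.trans (by gcongr)

end Output

end CEPAM

end

theorem mainTheorem1 {𝒰 Ω : Type*} [MeasurableSpace Ω] (μ : Measure Ω) [IsProbabilityMeasure μ]
    {K m d τ : ℕ} [NeZero K] [NeZero d] [NeZero τ]
    (S : CEPAM.Setup 𝒰 m d τ)
    (N : Fin K → ℕ) (hN : ∀ k, 0 < N k)
    (W : Ω → CEPAM.Vec m) (J : ∀ k, Fin τ → Ω → Fin (N k))
    (U : Fin K → Fin (m ⌈/⌉ d) → Ω → ℝ)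
    (V : Fin K → Fin (m ⌈/⌉ d) → ℕ → Ω → CEPAM.Vec d)
    (hR : CEPAM.IsRoundRandomness μ N S.P W J U V) :
    -- `X w D k`: clipped update of client `k` in the round started at `w` with the data `D`
    let X : CEPAM.Vec m → (∀ k, Fin (N k) → 𝒰) → Fin K → Ω → CEPAM.Vec m :=
      fun w D k ω => S.clippedUpdate w fun t => D k (J k t ω)
    -- `Xhat w D k`: its estimate at the server
    let Xhat : CEPAM.Vec m → (∀ k, Fin (N k) → 𝒰) → Fin K → Ω → CEPAM.Vec m :=
      fun w D k ω => S.estimate (X w D k ω) (fun j => U k j ω) (fun j i => V k j i ω)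
    (∀ D : ∀ k, Fin (N k) → 𝒰,
      -- `Z k j`: quantization error on the `j`-th sub-vector of client `k`
      let Z : Fin K → Fin (m ⌈/⌉ d) → Ω → CEPAM.Vec d := fun k j ω =>
        S.subError (X (W ω) D k ω) (fun j => U k j ω) (fun j i => V k j i ω) j
      (∀ k j, ∀ᵐ u ∂(CEPAM.chiSquared (d + 2)),
        condDistrib (Z k j) (U k j) μ u = volume[|Metric.closedBall 0 (S.σ * √u)]) ∧
      (∀ k j, HasLaw (Z k j) (multivariateGaussian 0 (S.σ ^ 2 • 1)) μ) ∧
      iIndepFun (fun (p : Fin K × Fin (m ⌈/⌉ d)) => Z p.1 p.2) μ ∧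
      IndepFun (fun ω k j => Z k j ω) (fun ω k => X (W ω) D k ω) μ ∧
      ∃ ζ : Ω → CEPAM.Vec m,
        (∀ ω, (1 / (K : ℝ)) • ∑ k, Xhat (W ω) D k ω =
          (1 / (K : ℝ)) • ∑ k, X (W ω) D k ω + ζ ω) ∧
        HasLaw ζ (multivariateGaussian 0 ((S.σ ^ 2 / K) • 1)) μ ∧
        IndepFun ζ (fun ω k => X (W ω) D k ω) μ) ∧
    (∀ (w : CEPAM.Vec m) (k : Fin K) (ε' : ℝ), 0 < ε' →
      CEPAM.IsDP (CEPAM.AdjClient k) μ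
        (fun D ω => (1 / (K : ℝ)) • ∑ k', Xhat w D k' ω)
        (CEPAM.privacyEps (N k) τ ε') (CEPAM.privacyDelta K (N k) τ S.γ S.σ ε')) := by
  intro X Xhat
  refine ⟨fun D => ?_, fun w k ε' hε' => CEPAM.isDP_output hN hR w k hε'⟩
  intro Z
  obtain ⟨h1, h2, h3, h4, h5, h6⟩ := CEPAM.gaussian_errors hR D
    (fun ω k => X (W ω) D k ω) rfl Z rfl
  exact ⟨h1, h2, h3, h4, fun ω => (1 / (K : ℝ)) • ∑ k, CEPAM.collect fun j => Z k j ω,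
    fun ω => S.average_estimate_eq _ _ _ _, h5, h6⟩
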